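/- Fix $t_0\in\mathbb R$, $\tau_{\max}>0$, $p\in[1,\infty]$, and integers $N,n,o,l,q\ge 0$, $m\ge 1$ ($m=0$ is also allowed). Consider a network of $N$ agents with states $x_i(t)\in\mathbb R^n$ and outputs $y_i(t)\in\mathbb R^{o}$, $$\dot x_i=f_i(x_i,t)+u_i(t)+d_i(t),\qquad y_i=g_i(x_i),\qquad d_i(t)=w_i(t)+\bar d_i(t),\quad \bar d_i(t)=\sum_{k=0}^{m-1}\bar d_{i,k}t^k ,$$ with the multiplex integral control $$u_i=h_{i,0}+h_{i,0}^{(\tau)}+r_{i,1},\qquad \dot r_{i,k}=h_{i,k}+h_{i,k}^{(\tau)}+r_{i,k+1}\ (1\le k\le m),\qquad r_{i,m+1}:=0 .$$ Here $h_{i,k}=h_{i,k}(x(t),x_l(t),t)$ depends on the current agent states and on a reference signal $x_l(t)\in\mathbb R^{l}$, and $h_{i,k}^{(\tau)}=h^{(\tau)}_{i,k}\big((x_j(t-\tau_\kappa(t)))_{\kappa,j},(x_l(t-\tau_\kappa(t)))_\kappa,t\big)$ depends on the delayed states and reference values, where $\tau_1,\dots,\tau_q$ are time-varying delays with $\tau_\kappa(t)\in(0,\tau_{\max}]$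 for $t\ge t_0$. The functions $f_i,h_{i,k},h_{i,k}^{(\tau)}$ are smooth ($C^1$ suffices), and $w$ is bounded and piecewise continuous on $[t_0,\infty)$. Solutions are continuous on $[t_0-\tau_{\max},\infty)$ and satisfy the equations for all $t>t_0$ outside a locally finite set. For $\eta\in\mathbb R^N_{>0}$ put $\|v\|_{\rm cmpst}=\max_i\|v_i\|_p/\eta_i$, with the induced operator norm denoted in the same way, and let $\mu_p(A)=\lim_{h\to0^+}(\|I+hA\|_p-1)/h$. Assume that $\|g_i(u)-g_i(v)\|_p\le L\|u-v\|_p$ for all $i,u,v$, for a constant $L\ge0$. Let $x^*$ be a desired solution: continuous on $[t_0-\tau_{\max},\infty)$, with $\dot x_i^*=f_i(x_i^*,t)$ for $t\ge t_0$; let $y_i^*=g_i(x_i^*)$. Let $T=\mathrm{diag}\{T_1,\dots,T_N\}$ with invertible $T_i\in\mathbb R^{(m+1)n\times(m+1)n}$, and let $0<\underline\sigma<\bar\sigma$. Suppose that for all $t\ge t_0$: * C1: $h_{i,k}=0$ and $h^{(\tau)}_{i,k}=0$ along $x^*$, for all $i$ and $0\le k\le m$; * C2: $\mu_p(T_i\tilde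 A_{ii}T_i^{-1})+\sum_{j\ne i}\frac{\eta_j}{\eta_i}\|T_i\tilde A_{ij}T_j^{-1}\|_p\le-\bar\sigma$ for all $i$, all $x$ and all $x_l$; * C3: $\sum_{\kappa=1}^q\sum_{j=1}^N\frac{\eta_j}{\eta_i}\|T_i(\tilde B_\kappa)_{ij}T_j^{-1}\|_p\le\underline\sigma$ for all $i$, all signals $x$ and all signals $x_l$. Here all matrices are $(m+1)\times(m+1)$ block matrices with $n\times n$ blocks. For $j\ne i$, $\tilde A_{ij}$ has first block column $(\partial h_{i,k}/\partial x_j)_{k=0}^m$ and zeros elsewhere. $\tilde A_{ii}$ has first block column $(\partial h_{i,k}/\partial x_i)_{k=0}^m$ with $\partial f_i/\partial x_i$ added to its top block, identity blocks on the first block superdiagonal, and zeros elsewhere. $(\tilde B_\kappa)_{ij}$ has first block column $(\partial h^{(\tau)}_{i,k}/\partial x_j(t-\tau_\kappa))_{k=0}^m$ and zeros elsewhere. Then the closed loop is Input-Output Stable with respect to $w$: there are class $\mathcal{KL}$ functions $\alpha,\beta$ and a class $\mathcal K$ function $\gamma$ such that for all $\bar d$ and $w$ as above, all solutions $(x,r)$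 and all $t\ge t_0$, $$\|y(t)-y^*(t)\|_{\rm cmpst}\le\alpha\Big(\sup_{s\in[t_0-\tau_{\max},t_0]}\|x(s)-x^*(s)\|_{\rm cmpst},\,t-t_0\Big)+\beta\Big(\sup_{s\in[t_0-\tau_{\max},t_0]}\sum_{k=1}^m\|r_k(s)+\bar d^{(k-1)}(s)\|_{\rm cmpst},\,t-t_0\Big)+\gamma\Big(\sup_{s\ge t_0}\|w(s)\|_{\rm cmpst}\Big).$$ Moreover, the equation $\lambda-\bar\sigma+\underline\sigma e^{\lambda\tau_{\max}}=0$ has a unique real solution $\lambda$, it is positive, and for all such $\bar d,w$, all solutions $(x,r)$ and all $t\ge t_0$, $$\begin{aligned}\|y(t)-y^*(t)\|_{\rm cmpst}\le L\Big[&\|T^{-1}\|_{\rm cmpst}\|T\|_{\rm cmpst}\,e^{-\lambda(t-t_0)}\Big(\sup_{s\in[t_0-\tau_{\max},t_0]}\|x(s)-x^*(s)\|_{\rm cmpst}\\&+\sup_{s\in[t_0-\tau_{\max},t_0]}\sum_{k=1}^m\Big\|\sum_{b=0}^{m-k}\tfrac{(m-1-b)!}{(m-k-b)!}\,\bar d_{m-1-b}\,s^{m-k-b}+r_k(s)\Big\|_{\rm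 cmpst}\Big)+\frac{\|T^{-1}\|_{\rm cmpst}\|T\|_{\rm cmpst}}{\bar\sigma-\underline\sigma}\sup_{s\ge t_0}\|w(s)\|_{\rm cmpst}\Big].\end{aligned}$$ -/

import Mathlib

open Set Filter Topology
open scoped ENNReal NNReal Nat

/-! ### Norms, induced norms and matrix measures -/

/-- The `ℓ^p` norm of a real vector. -/
noncomputable def lpNorm {ι : Type*} [Fintype ι] (p : ℝ≥0∞) [Fact (1 ≤ p)] (v : ι → ℝ) : ℝ :=
  ‖WithLp.toLp p v‖

/-- The matrix norm induced by the `ℓ^p` norm: the operator norm of `v ↦ A v` on `ℓ^p`. -/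
noncomputable def lpOpNorm {ι : Type*} [Fintype ι] [DecidableEq ι] (p : ℝ≥0∞) [Fact (1 ≤ p)]
    (A : Matrix ι ι ℝ) : ℝ :=
  ‖LinearMap.toContinuousLinearMap (Matrix.toLpLin p p A)‖

/-- The matrix measure (logarithmic norm) `μ_p(A) = lim_{h → 0⁺} (‖I + h A‖_p - 1) / h`. -/
noncomputable def matrixMeasure {ι : Type*} [Fintype ι] [DecidableEq ι] (p : ℝ≥0∞) [Fact (1 ≤ p)]
    (A : Matrix ι ι ℝ) : ℝ :=
  limUnder (𝓝[>] (0 : ℝ)) (fun h : ℝ => (lpOpNorm p (1 + h • A) - 1) / h)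

/-- The composite norm `‖x‖_cmpst = max_i ‖x_i‖_p / η_i` of `x = (x_1, …, x_N)`. -/
noncomputable def cmpstNorm {N : ℕ} {ι : Type*} [Fintype ι] (p : ℝ≥0∞) [Fact (1 ≤ p)]
    (η : Fin N → ℝ) (x : Fin N → ι → ℝ) : ℝ :=
  ⨆ i, lpNorm p (x i) / η i

/-- The operator norm induced by the composite norm, `sup {‖Φ x‖_cmpst : ‖x‖_cmpst ≤ 1}`. -/
noncomputable def cmpstOpNorm {N : ℕ} {ι : Type*} [Fintype ι] (p : ℝ≥0∞) [Fact (1 ≤ p)]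
    (η : Fin N → ℝ) (Φ : (Fin N → ι → ℝ) →ₗ[ℝ] (Fin N → ι → ℝ)) : ℝ :=
  sSup {c : ℝ | ∃ x : Fin N → ι → ℝ, cmpstNorm p η x ≤ 1 ∧ c = cmpstNorm p η (Φ x)}

/-- The block diagonal map `diag{T_1, …, T_N}`, i.e. `(x_1, …, x_N) ↦ (T_1 x_1, …, T_N x_N)`. -/
noncomputable def blockDiag {N : ℕ} {ι : Type*} [Fintype ι] (T : Fin N → Matrix ι ι ℝ) :
    (Fin N → ι → ℝ) →ₗ[ℝ] (Fin N → ι → ℝ) :=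
  LinearMap.pi fun i => (T i).mulVecLin ∘ₗ LinearMap.proj i

/-! ### Comparison functions -/

/-- Class `K` functions (on `[0, ∞)`). -/
def IsClassK (γ : ℝ → ℝ) : Prop :=
  ContinuousOn γ (Ici 0) ∧ StrictMonoOn γ (Ici 0) ∧ γ 0 = 0

/-- Class `KL` functions (on `[0, ∞) × [0, ∞)`). -/
def IsClassKL (β : ℝ → ℝ → ℝ) : Prop :=
  ContinuousOn (fun z : ℝ × ℝ => β z.1 z.2) (Ici 0 ×ˢ Ici 0) ∧
  (∀ s, 0 ≤ s → IsClassK (fun r => β r s)) ∧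
  (∀ r, 0 ≤ r → AntitoneOn (β r) (Ici 0) ∧ Tendsto (β r) atTop (𝓝 0))

/-! ### The network -/

/-- Data of a network of `N` agents with states in `ℝ^n`, outputs in `ℝ^o`, a reference signal with
values in `ℝ^l`, multiplex integral control with layers `0, …, m`, and `q` time-varying delays
(a relabelling of the delays `τ_{ij}`, `τ_{il}`).

The delay-free coupling `h i k` may depend on the current states of all agents (it is constant in
the states of agents that are not neighbours of `i`), on the current value of the reference signal
and on time. The delayed coupling `hDelayed i k` takes as arguments
the delayed states `x_j(t - τ_κ(t))` for all labels `κ` and agents `j`, the delayed reference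
values `x_l(t - τ_κ(t))`, and time. -/
structure MultiplexNetwork (N n o l m q : ℕ) where
  /-- intrinsic dynamics `f_i(x_i, t)` -/
  f : Fin N → (Fin n → ℝ) → ℝ → (Fin n → ℝ)
  /-- output functions `g_i(x_i)` -/
  g : Fin N → (Fin n → ℝ) → (Fin o → ℝ)
  /-- delay-free coupling functions `h_{i,k}` -/
  h : Fin N → Fin (m + 1) → (Fin N → Fin n → ℝ) → (Fin l → ℝ) → ℝ → (Fin n → ℝ)
  /-- delayed coupling functions `h_{i,k}^{(τ)}` -/
  hDelayed : Fin N → Fin (m + 1) → (Fin q → Fin N → Fin n → ℝ) → (Fin q → Fin l → ℝ) → ℝ →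
    (Fin n → ℝ)
  /-- the delays `τ_κ(t)` -/
  τ : Fin q → ℝ → ℝ

namespace MultiplexNetwork

variable {N n o l m q : ℕ}

/-- The functions `f_i`, `h_{i,k}`, `h_{i,k}^{(τ)}` are continuously differentiable, jointly in all
their arguments. -/
def IsSmooth (net : MultiplexNetwork N n o l m q) : Prop :=
  (∀ i, ContDiff ℝ 1 fun z : (Fin n → ℝ) × ℝ => net.f i z.1 z.2) ∧
  (∀ i k, ContDiff ℝ 1 fun z : (Fin N → Fin n → ℝ) × (Fin l → ℝ) × ℝ =>
    net.h i k z.1 z.2.1 z.2.2) ∧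
  (∀ i k, ContDiff ℝ 1 fun z : (Fin q → Fin N → Fin n → ℝ) × (Fin q → Fin l → ℝ) × ℝ =>
    net.hDelayed i k z.1 z.2.1 z.2.2)

/-- `h_{i,k} + h_{i,k}^{(τ)}` evaluated at time `t` along the signals `x` and `xl`. -/
def coupling (net : MultiplexNetwork N n o l m q) (xl : ℝ → Fin l → ℝ)
    (x : ℝ → Fin N → Fin n → ℝ) (i : Fin N) (k : Fin (m + 1)) (t : ℝ) : Fin n → ℝ :=
  net.h i k (x t) (xl t) t +
    net.hDelayed i k (fun κ => x (t - net.τ κ t)) (fun κ => xl (t - net.τ κ t)) t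

/-- The signal produced by layer `k`: the coupling plus the integrator state `r_{i,k+1}` passed down
by the layer above (nothing for the top layer `k = m`). Here `r t k i` with `k : Fin m` is
`r_{i,k+1}(t)`. The control input `u_i` is the signal of layer `0`. -/
def layerSignal (net : MultiplexNetwork N n o l m q) (xl : ℝ → Fin l → ℝ)
    (x : ℝ → Fin N → Fin n → ℝ) (r : ℝ → Fin m → Fin N → Fin n → ℝ)
    (i : Fin N) (k : Fin (m + 1)) (t : ℝ) : Fin n → ℝ :=
  net.coupling xl x i k t + if hk : (k : ℕ) < m then r t ⟨k, hk⟩ i else 0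

/-- The polynomial disturbance `∑_{k=0}^{m-1} d̄_{i,k} t^k`; only `dbar k` with `k < m` is used. -/
def polyDisturbance (m : ℕ) (dbar : ℕ → Fin N → Fin n → ℝ) (i : Fin N) (t : ℝ) : Fin n → ℝ :=
  ∑ k ∈ Finset.range m, t ^ k • dbar k i

/-- `(x, r)` is a solution on `[t0, ∞)` of the closed loop with polynomial disturbance coefficients
`dbar` and residual disturbance `w`, with continuous history on `[t0 - τmax, t0]`. The trajectories
are continuous and the differential equations hold at all `t > t0` except for finitely many in each
bounded interval (the discontinuities of a piecewise continuous `w`). -/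
structure IsSolution (net : MultiplexNetwork N n o l m q) (t0 τmax : ℝ) (xl : ℝ → Fin l → ℝ)
    (dbar : ℕ → Fin N → Fin n → ℝ) (w : ℝ → Fin N → Fin n → ℝ)
    (x : ℝ → Fin N → Fin n → ℝ) (r : ℝ → Fin m → Fin N → Fin n → ℝ) : Prop where
  continuousOn_x : ContinuousOn x (Ici (t0 - τmax))
  continuousOn_r : ContinuousOn r (Ici (t0 - τmax))
  ode : ∃ S : Set ℝ, (∀ b : ℝ, (S ∩ Icc t0 b).Finite) ∧ ∀ t, t0 < t → t ∉ S →
    (∀ i, HasDerivAt (fun s => x s i)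
      (net.f i (x t i) t + net.layerSignal xl x r i 0 t + (w t i + polyDisturbance m dbar i t)) t) ∧
    (∀ (k : Fin m) (i : Fin N), HasDerivAt (fun s => r s k i)
      (net.layerSignal xl x r i k.succ t) t)

/-- The desired solution: `ẋ_i^* = f_i(x_i^*, t)` for `t ≥ t0`, continuous on `[t0 - τmax, ∞)`
(its integrator states are `0`). -/
def IsDesiredSolution (net : MultiplexNetwork N n o l m q) (t0 τmax : ℝ)
    (xs : ℝ → Fin N → Fin n → ℝ) : Prop :=
  ContinuousOn xs (Ici (t0 - τmax)) ∧
  ∀ t, t0 ≤ t → ∀ i, HasDerivWithinAt (fun s => xs s i) (net.f i (xs t i) t) (Ici t0) t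

/-- The composite norm of the output deviation `y(t) - y^*(t)`. -/
noncomputable def outputError (net : MultiplexNetwork N n o l m q) (p : ℝ≥0∞) [Fact (1 ≤ p)]
    (η : Fin N → ℝ) (xs x : ℝ → Fin N → Fin n → ℝ) (t : ℝ) : ℝ :=
  cmpstNorm p η fun i => net.g i (x t i) - net.g i (xs t i)

/-- Input-Output Stability with respect to `w`, relative to the desired solution `xs`. Here
`r s k` is the integrator state of layer `k + 1`, and is shifted by the `k`-th derivative of the
polynomial disturbance. The residual disturbance `w` is bounded on `[t0, ∞)`. -/
def IsInputOutputStable (net : MultiplexNetwork N n o l m q) (p : ℝ≥0∞) [Fact (1 ≤ p)]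
    (η : Fin N → ℝ) (t0 τmax : ℝ) (xl : ℝ → Fin l → ℝ) (xs : ℝ → Fin N → Fin n → ℝ) : Prop :=
  ∃ (α β : ℝ → ℝ → ℝ) (γ : ℝ → ℝ), IsClassKL α ∧ IsClassKL β ∧ IsClassK γ ∧
    ∀ (dbar : ℕ → Fin N → Fin n → ℝ) (w : ℝ → Fin N → Fin n → ℝ)
      (x : ℝ → Fin N → Fin n → ℝ) (r : ℝ → Fin m → Fin N → Fin n → ℝ),
      BddAbove (range fun s : Ici t0 => cmpstNorm p η (w s)) →
      net.IsSolution t0 τmax xl dbar w x r →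
      ∀ t, t0 ≤ t →
        net.outputError p η xs x t ≤
          α (⨆ s : Icc (t0 - τmax) t0, cmpstNorm p η (x s - xs s)) (t - t0) +
          β (⨆ s : Icc (t0 - τmax) t0, ∑ k : Fin m, cmpstNorm p η
              (fun i => r s k i + iteratedDeriv (k : ℕ) (polyDisturbance m dbar i) s)) (t - t0) +
          γ (⨆ s : Ici t0, cmpstNorm p η (w s))

/-! ### Jacobian blocks -/

/-- The Jacobian matrix of `F : ℝ^n → ℝ^n` at `v`. -/
noncomputable def jacobian (F : (Fin n → ℝ) → (Fin n → ℝ)) (v : Fin n → ℝ) :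
    Matrix (Fin n) (Fin n) ℝ :=
  LinearMap.toMatrix' (fderiv ℝ F v : (Fin n → ℝ) →ₗ[ℝ] (Fin n → ℝ))

/-- The partial Jacobian `∂h_{i,k}/∂x_j` at the states `x`, reference value `xl` and time `t`. -/
noncomputable def dh (net : MultiplexNetwork N n o l m q) (i j : Fin N) (k : Fin (m + 1))
    (x : Fin N → Fin n → ℝ) (xl : Fin l → ℝ) (t : ℝ) : Matrix (Fin n) (Fin n) ℝ :=
  jacobian (fun v => net.h i k (Function.update x j v) xl t) (x j)

/-- The partial Jacobian of `h_{i,k}^{(τ)}` with respect to the argument `x_j(t - τ_κ(t))`, at the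
delayed states `ξ`, delayed reference values `ζ` and time `t`. -/
noncomputable def dhDelayed (net : MultiplexNetwork N n o l m q) (κ : Fin q) (i j : Fin N)
    (k : Fin (m + 1)) (ξ : Fin q → Fin N → Fin n → ℝ) (ζ : Fin q → Fin l → ℝ) (t : ℝ) :
    Matrix (Fin n) (Fin n) ℝ :=
  jacobian (fun v => net.hDelayed i k (Function.update ξ κ (Function.update (ξ κ) j v)) ζ t)
    (ξ κ j)

/-- The `(m+1) × (m+1)` block matrix whose first block column is `C` and whose other blocks are
zero. -/
def firstColumn (C : Fin (m + 1) → Matrix (Fin n) (Fin n) ℝ) :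
    Matrix (Fin (m + 1) × Fin n) (Fin (m + 1) × Fin n) ℝ :=
  Matrix.of fun a b => if b.1 = 0 then C a.1 a.2 b.2 else 0

/-- The `(m+1) × (m+1)` block matrix with identity blocks on the first block superdiagonal. -/
def shiftBlocks (m n : ℕ) : Matrix (Fin (m + 1) × Fin n) (Fin (m + 1) × Fin n) ℝ :=
  Matrix.of fun a b => if (b.1 : ℕ) = a.1 + 1 ∧ a.2 = b.2 then 1 else 0

/-- The delay-free Jacobian blocks `Ã_{ij}` (both for `j = i` and for `j ≠ i`). -/
noncomputable def blockA (net : MultiplexNetwork N n o l m q) (i j : Fin N)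
    (x : Fin N → Fin n → ℝ) (xl : Fin l → ℝ) (t : ℝ) :
    Matrix (Fin (m + 1) × Fin n) (Fin (m + 1) × Fin n) ℝ :=
  if j = i then
    firstColumn (fun k =>
      (if k = 0 then jacobian (fun v => net.f i v t) (x i) else 0) + net.dh i i k x xl t)
    + shiftBlocks m n
  else firstColumn fun k => net.dh i j k x xl t

/-- The delayed Jacobian blocks `(B̃_κ)_{ij}`. -/
noncomputable def blockB (net : MultiplexNetwork N n o l m q) (κ : Fin q) (i j : Fin N)
    (ξ : Fin q → Fin N → Fin n → ℝ) (ζ : Fin q → Fin l → ℝ) (t : ℝ) :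
    Matrix (Fin (m + 1) × Fin n) (Fin (m + 1) × Fin n) ℝ :=
  firstColumn fun k => net.dhDelayed κ i j k ξ ζ t

/-! ### The three conditions -/

/-- Condition C1: all couplings vanish along the desired solution. -/
def CondC1 (net : MultiplexNetwork N n o l m q) (t0 : ℝ) (xl : ℝ → Fin l → ℝ)
    (xs : ℝ → Fin N → Fin n → ℝ) : Prop :=
  ∀ t, t0 ≤ t → ∀ i k,
    net.h i k (xs t) (xl t) t = 0 ∧
    net.hDelayed i k (fun κ => xs (t - net.τ κ t)) (fun κ => xl (t - net.τ κ t)) t = 0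

/-- Condition C2, for all states and all reference values. -/
def CondC2 (net : MultiplexNetwork N n o l m q) (p : ℝ≥0∞) [Fact (1 ≤ p)] (η : Fin N → ℝ)
    (T : Fin N → Matrix (Fin (m + 1) × Fin n) (Fin (m + 1) × Fin n) ℝ) (t0 σ : ℝ) : Prop :=
  ∀ t, t0 ≤ t → ∀ (x : Fin N → Fin n → ℝ) (xl : Fin l → ℝ) (i : Fin N),
    matrixMeasure p (T i * net.blockA i i x xl t * (T i)⁻¹) +
      ∑ j ∈ Finset.univ.erase i,
        η j / η i * lpOpNorm p (T i * net.blockA i j x xl t * (T j)⁻¹) ≤ -σ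

/-- Condition C3, for all state signals and all reference signals, evaluated at the delayed
times. -/
def CondC3 (net : MultiplexNetwork N n o l m q) (p : ℝ≥0∞) [Fact (1 ≤ p)] (η : Fin N → ℝ)
    (T : Fin N → Matrix (Fin (m + 1) × Fin n) (Fin (m + 1) × Fin n) ℝ) (t0 σ : ℝ) : Prop :=
  ∀ t, t0 ≤ t → ∀ (x : ℝ → Fin N → Fin n → ℝ) (xl : ℝ → Fin l → ℝ) (i : Fin N),
    ∑ κ : Fin q, ∑ j : Fin N, η j / η i *
      lpOpNorm p (T i * net.blockB κ i j (fun κ' => x (t - net.τ κ' t))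
        (fun κ' => xl (t - net.τ κ' t)) t * (T j)⁻¹) ≤ σ

/-- The shifted integrator state of layer `k + 1` (where `k : Fin m`) of agent `i`; with `k' = k + 1`
it reads `∑_{b=0}^{m-k'} (m-1-b)!/(m-k'-b)! d̄_{i,m-1-b} s^{m-k'-b} + r_{i,k'}(s)`. -/
noncomputable def shiftedIntegrator (dbar : ℕ → Fin N → Fin n → ℝ)
    (r : ℝ → Fin m → Fin N → Fin n → ℝ) (k : Fin m) (s : ℝ) (i : Fin N) : Fin n → ℝ :=
  (∑ b ∈ Finset.range (m - (k + 1) + 1),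
    ((((m - 1 - b)! : ℕ) : ℝ) / (((m - (k + 1) - b)! : ℕ) : ℝ) * s ^ (m - (k + 1) - b)) •
      dbar (m - 1 - b) i) + r s k i

end MultiplexNetwork

/-! ### `ℓ^p` norms and matrix measures -/

section LpNorm

variable {ι κ : Type*} [Fintype ι] [Fintype κ] {p : ℝ≥0∞} [Fact (1 ≤ p)]

/-! For each agent, stack `x_i - x_i^*` on top of the integrator states, shifting `r_{i,k}` by the
`(k-1)`-th derivative of the polynomial disturbance. Each layer then absorbs one derivative, and
since the degree is below `m` nothing is left in the top layer. By C1 the stacked error obeys a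
delayed equation driven by `w` alone (`hasDerivAt_stackedError`).

Work with `T_i z_i`, where `z_i` is the stacked error, and let `ψ` be a functional of norm at most
one that norms this vector. It satisfies `ψ(A v) ≤ μ_p(A) ‖v‖` when it norms `v`
(`dual_mulVec_le_matrixMeasure`). The scalar mean value theorem along the segment from the desired
to the actual states puts all Jacobians at a single intermediate point. C2 and C3 hold at every
point, so they bound `ψ` of the field difference by `-σbar` times the current size plus `σlow` times
the delayed size (`dual_stackedField_sub_le`).

A Halanay argument (`norm_le_of_halanay`) turns this into exponential decay at rate `λ` plus a
constant proportional to `sup ‖w‖`: a curve cannot cross the explicit barrier, because at a first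
contact `ψ` of the curve would grow more slowly than the barrier. Testing with `ψ` avoids
differentiating the norm. Undoing `T` and applying the Lipschitz bound on the outputs gives the
explicit estimate, from which the comparison functions are read off. -/

theorem lpNorm_nonneg (v : ι → ℝ) : 0 ≤ lpNorm p v := norm_nonneg _

theorem lpNorm_zero : lpNorm p (0 : ι → ℝ) = 0 := by simp [lpNorm]

theorem lpNorm_smul (c : ℝ) (v : ι → ℝ) : lpNorm p (c • v) = |c| * lpNorm p v := by
  simp [lpNorm, norm_smul]

theorem continuous_lpNorm : Continuous (lpNorm p : (ι → ℝ) → ℝ) :=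
  (PiLp.continuous_toLp p _).norm

theorem toReal_pos_of_one_le_of_ne_top (hp : p ≠ ∞) : 0 < p.toReal :=
  ENNReal.toReal_pos (zero_lt_one.trans_le Fact.out).ne' hp

theorem lpNorm_comp_le {e : κ → ι} (he : Function.Injective e) (v : ι → ℝ) :
    lpNorm p (v ∘ e) ≤ lpNorm p v := by
  rcases eq_or_ne p ∞ with rfl | hp
  · refine Real.iSup_le (fun i => ?_) (norm_nonneg _)
    exact PiLp.norm_apply_le (WithLp.toLp ∞ v) (e i)
  · have hp0 := toReal_pos_of_one_le_of_ne_top hp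
    simp only [lpNorm, PiLp.norm_eq_sum hp0]
    refine Real.rpow_le_rpow (Finset.sum_nonneg fun i _ => by positivity) ?_ (by positivity)
    refine (Finset.sum_map Finset.univ ⟨e, he⟩ (fun i => ‖v i‖ ^ p.toReal)).ge.trans ?_
    exact Finset.sum_le_sum_of_subset_of_nonneg (Finset.subset_univ _)
      fun i _ _ => by positivity

theorem lpNorm_le_comp {e : κ → ι} (he : Function.Injective e) {v : ι → ℝ}
    (hv : ∀ i, i ∉ range e → v i = 0) : lpNorm p v ≤ lpNorm p (v ∘ e) := by
  rcases eq_or_ne p ∞ with rfl | hp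
  · refine Real.iSup_le (fun i => ?_) (norm_nonneg _)
    by_cases hi : i ∈ range e
    · obtain ⟨j, rfl⟩ := hi
      exact PiLp.norm_apply_le (WithLp.toLp ∞ (v ∘ e)) j
    · have : ‖WithLp.toLp ∞ v i‖ = 0 := by simp [hv i hi]
      exact this.le.trans (norm_nonneg _)
  · have hp0 := toReal_pos_of_one_le_of_ne_top hp
    simp only [lpNorm, PiLp.norm_eq_sum hp0]
    refine le_of_eq ?_
    congr 1
    refine (Fintype.sum_of_injective e he _ _ (fun i hi => ?_) fun i => rfl).symm
    simp [hv i hi, Real.zero_rpow hp0.ne']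

theorem dual_le_lpNorm {ψ : StrongDual ℝ (PiLp p fun _ : ι => ℝ)} (hψ : ‖ψ‖ ≤ 1) (v : ι → ℝ) :
    ψ (WithLp.toLp p v) ≤ lpNorm p v := by
  refine (le_abs_self _).trans ((ψ.le_opNorm _).trans ?_)
  exact mul_le_of_le_one_left (norm_nonneg _) hψ

variable [DecidableEq ι]

theorem lpOpNorm_nonneg (A : Matrix ι ι ℝ) : 0 ≤ lpOpNorm p A := norm_nonneg _

theorem lpNorm_mulVec_le (A : Matrix ι ι ℝ) (v : ι → ℝ) :
    lpNorm p (A.mulVec v) ≤ lpOpNorm p A * lpNorm p v := by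
  have := (LinearMap.toContinuousLinearMap (Matrix.toLpLin p p A)).le_opNorm (WithLp.toLp p v)
  simpa [lpNorm, lpOpNorm, Matrix.toLpLin_toLp] using this

theorem dual_mulVec_le_lpOpNorm {ψ : StrongDual ℝ (PiLp p fun _ : ι => ℝ)} (hψ : ‖ψ‖ ≤ 1)
    (A : Matrix ι ι ℝ) (v : ι → ℝ) :
    ψ (WithLp.toLp p (A.mulVec v)) ≤ lpOpNorm p A * lpNorm p v :=
  (dual_le_lpNorm hψ _).trans (lpNorm_mulVec_le A v)

theorem lpOpNorm_one [Nonempty ι] : lpOpNorm p (1 : Matrix ι ι ℝ) = 1 := by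
  have : LinearMap.toContinuousLinearMap (Matrix.toLpLin p p (1 : Matrix ι ι ℝ))
      = ContinuousLinearMap.id ℝ (PiLp p fun _ : ι => ℝ) := by
    rw [Matrix.toLpLin_one]; rfl
  rw [lpOpNorm, this, ContinuousLinearMap.norm_id]

/-- A norm composed with an affine map is convex. Convexity supplies the one-sided derivative at
`0`, hence the existence of the limit behind `matrixMeasure`. -/
theorem convexOn_lpOpNorm_one_add_smul (A : Matrix ι ι ℝ) :
    ConvexOn ℝ univ fun h : ℝ => lpOpNorm p (1 + h • A) := by
  refine ⟨convex_univ, fun x _ y _ a b ha hb hab => ?_⟩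
  have : (1 + (a • x + b • y) • A : Matrix ι ι ℝ) = a • (1 + x • A) + b • (1 + y • A) := by
    have h1 : (1 : Matrix ι ι ℝ) = (a + b) • (1 : Matrix ι ι ℝ) := by rw [hab, one_smul]
    conv_lhs => rw [h1]
    simp only [smul_eq_mul]
    module
  simp only [lpOpNorm, this, map_add (Matrix.toLpLin p p) (a • _), map_smul (Matrix.toLpLin p p) a,
    map_smul (Matrix.toLpLin p p) b, map_add LinearMap.toContinuousLinearMap (a • _),
    map_smul LinearMap.toContinuousLinearMap a, map_smul LinearMap.toContinuousLinearMap b]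
  refine (norm_add_le _ _).trans (le_of_eq ?_)
  rw [norm_smul, norm_smul, Real.norm_of_nonneg ha, Real.norm_of_nonneg hb]
  rfl

/-- `limUnder` carries information only once convergence is known. As `‖I‖ = 1`, which needs a
nonempty index type, the quotient is the slope at `0` of a convex function. -/
theorem tendsto_matrixMeasure [Nonempty ι] (A : Matrix ι ι ℝ) :
    Tendsto (fun h : ℝ => (lpOpNorm p (1 + h • A) - 1) / h) (𝓝[>] (0 : ℝ))
      (𝓝 (matrixMeasure p A)) := by
  have h := (convexOn_lpOpNorm_one_add_smul (p := p) A).hasDerivWithinAt_rightDeriv_of_mem_interior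
    (x := 0) (by simp)
  rw [hasDerivWithinAt_iff_tendsto_slope' (by simp)] at h
  refine tendsto_nhds_limUnder ⟨_, h.congr fun t => ?_⟩
  simp [slope_def_field, lpOpNorm_one]

/-- Subtract `ψ v = ‖v‖` from `ψ((I + hA)v) ≤ ‖I + hA‖ ‖v‖`, divide by `h > 0` and let `h → 0⁺`. -/
theorem dual_mulVec_le_matrixMeasure {ψ : StrongDual ℝ (PiLp p fun _ : ι => ℝ)} (hψ : ‖ψ‖ ≤ 1)
    {v : ι → ℝ} (hv : ψ (WithLp.toLp p v) = lpNorm p v) (A : Matrix ι ι ℝ) :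
    ψ (WithLp.toLp p (A.mulVec v)) ≤ matrixMeasure p A * lpNorm p v := by
  cases isEmpty_or_nonempty ι
  · rw [Subsingleton.elim (A.mulVec v) 0, Subsingleton.elim v 0, lpNorm_zero]; simp
  refine ge_of_tendsto ((tendsto_matrixMeasure (p := p) A).mul_const (lpNorm p v)) ?_
  filter_upwards [self_mem_nhdsWithin] with h hh
  have hh : 0 < h := hh
  have key := dual_mulVec_le_lpOpNorm hψ (1 + h • A) v
  rw [Matrix.add_mulVec, Matrix.one_mulVec, Matrix.smul_mulVec, WithLp.toLp_add,
    WithLp.toLp_smul, map_add, map_smul, hv, smul_eq_mul] at key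
  rw [div_mul_eq_mul_div, le_div_iff₀ hh]
  linarith

end LpNorm

/-! ### Composite norms -/

section CmpstNorm

variable {N : ℕ} {ι : Type*} [Fintype ι] {p : ℝ≥0∞} [Fact (1 ≤ p)] {η : Fin N → ℝ}

theorem lpNorm_div_le_cmpstNorm (x : Fin N → ι → ℝ) (i : Fin N) :
    lpNorm p (x i) / η i ≤ cmpstNorm p η x :=
  le_ciSup (f := fun i => lpNorm p (x i) / η i) (Set.finite_range _).bddAbove i

theorem lpNorm_le_mul_cmpstNorm (hη : ∀ i, 0 < η i) (x : Fin N → ι → ℝ) (i : Fin N) :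
    lpNorm p (x i) ≤ η i * cmpstNorm p η x := by
  have := lpNorm_div_le_cmpstNorm (p := p) (η := η) x i
  rwa [div_le_iff₀' (hη i)] at this

theorem cmpstNorm_nonneg (hη : ∀ i, 0 < η i) (x : Fin N → ι → ℝ) : 0 ≤ cmpstNorm p η x :=
  Real.iSup_nonneg fun i => div_nonneg (lpNorm_nonneg _) (hη i).le

theorem cmpstNorm_le (hη : ∀ i, 0 < η i) {x : Fin N → ι → ℝ} {a : ℝ} (ha : 0 ≤ a)
    (h : ∀ i, lpNorm p (x i) ≤ η i * a) : cmpstNorm p η x ≤ a :=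
  Real.iSup_le (fun i => by rw [div_le_iff₀' (hη i)]; exact h i) ha

theorem cmpstNorm_smul (c : ℝ) (x : Fin N → ι → ℝ) :
    cmpstNorm p η (c • x) = |c| * cmpstNorm p η x := by
  simp only [cmpstNorm, Pi.smul_apply, lpNorm_smul, mul_div_assoc]
  exact (Real.mul_iSup_of_nonneg (abs_nonneg c) _).symm

theorem cmpstOpNorm_nonneg (hη : ∀ i, 0 < η i) (Φ : (Fin N → ι → ℝ) →ₗ[ℝ] (Fin N → ι → ℝ)) :
    0 ≤ cmpstOpNorm p η Φ :=
  Real.sSup_nonneg fun _ ⟨_, _, hc⟩ => hc ▸ cmpstNorm_nonneg hη _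

theorem continuous_cmpstNorm : Continuous (cmpstNorm p η : (Fin N → ι → ℝ) → ℝ) := by
  rcases isEmpty_or_nonempty (Fin N) with hN | hN
  · have : (cmpstNorm p η : (Fin N → ι → ℝ) → ℝ) = fun _ => 0 := by
      funext x; simp [cmpstNorm]
    rw [this]; exact continuous_const
  · have : (cmpstNorm p η : (Fin N → ι → ℝ) → ℝ) =
        fun x => Finset.univ.sup' Finset.univ_nonempty fun i => lpNorm p (x i) / η i := by
      funext x; rw [Finset.sup'_univ_eq_ciSup]; rfl
    rw [this]
    exact Continuous.finset_sup'_apply _ fun i _ =>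
      (continuous_lpNorm.comp (continuous_apply i)).div_const _

variable [DecidableEq ι]

theorem cmpstNorm_blockDiag_le (hη : ∀ i, 0 < η i) (T : Fin N → Matrix ι ι ℝ)
    (x : Fin N → ι → ℝ) :
    cmpstNorm p η (blockDiag T x) ≤ cmpstOpNorm p η (blockDiag T) * cmpstNorm p η x := by
  -- This crude constant serves twice: it bounds the set whose real supremum is the operator norm,
  -- and it settles vectors of norm zero, which cannot be normalised.
  have bound : ∀ y, cmpstNorm p η (blockDiag T y) ≤
      (∑ i, lpOpNorm p (T i)) * cmpstNorm p η y := fun y => by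
    refine cmpstNorm_le hη (mul_nonneg (Finset.sum_nonneg fun i _ => lpOpNorm_nonneg _)
      (cmpstNorm_nonneg hη _)) fun i => ?_
    refine (lpNorm_mulVec_le (T i) (y i)).trans ?_
    calc lpOpNorm p (T i) * lpNorm p (y i)
        ≤ (∑ i, lpOpNorm p (T i)) * (η i * cmpstNorm p η y) :=
          mul_le_mul (Finset.single_le_sum (f := fun i => lpOpNorm p (T i))
            (fun i _ => lpOpNorm_nonneg _) (Finset.mem_univ i))
            (lpNorm_le_mul_cmpstNorm hη y i) (lpNorm_nonneg _)
            (Finset.sum_nonneg fun i _ => lpOpNorm_nonneg _)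
      _ = _ := by ring
  rcases (cmpstNorm_nonneg (p := p) hη x).eq_or_lt with h0 | h0
  · have := bound x
    rwa [← h0, mul_zero] at this ⊢
  have hle : cmpstNorm p η (blockDiag T ((cmpstNorm p η x)⁻¹ • x)) ≤
      cmpstOpNorm p η (blockDiag T) := by
    refine le_csSup ⟨∑ i, lpOpNorm p (T i), ?_⟩ ⟨_, ?_, rfl⟩
    · rintro _ ⟨y, hy, rfl⟩
      exact (bound y).trans
        (mul_le_of_le_one_right (Finset.sum_nonneg fun i _ => lpOpNorm_nonneg _) hy)
    · rw [cmpstNorm_smul, abs_of_pos (inv_pos.2 h0), inv_mul_cancel₀ h0.ne']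
  rw [map_smul, cmpstNorm_smul, abs_of_pos (inv_pos.2 h0), inv_mul_le_iff₀ h0] at hle
  linarith

end CmpstNorm

/-! ### A vector-valued Halanay inequality -/

/-- The left-hand side is strictly increasing in the rate, negative at `0` and positive at `σbar`.
-/
theorem existsUnique_halanay_rate {σlow σbar τmax : ℝ} (hσlow : 0 < σlow) (hσ : σlow < σbar)
    (hτmax : 0 < τmax) :
    ∃ lam : ℝ, 0 < lam ∧ lam - σbar + σlow * Real.exp (lam * τmax) = 0 ∧
      ∀ lam' : ℝ, lam' - σbar + σlow * Real.exp (lam' * τmax) = 0 → lam' = lam := by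
  set g : ℝ → ℝ := fun a => a - σbar + σlow * Real.exp (a * τmax) with hg
  have hmono : StrictMono g := fun a b hab => by
    have : Real.exp (a * τmax) < Real.exp (b * τmax) :=
      Real.exp_lt_exp.2 (mul_lt_mul_of_pos_right hab hτmax)
    have := mul_lt_mul_of_pos_left this hσlow
    simp only [hg]; linarith
  have hcont : Continuous g := by fun_prop
  have h0 : g 0 < 0 := by simp [hg, hσ]
  have h1 : 0 < g σbar := by simp only [hg, sub_self, zero_add]; positivity
  obtain ⟨lam, hlam, hz⟩ := intermediate_value_Ioo (by linarith : (0 : ℝ) ≤ σbar)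
    hcont.continuousOn ⟨h0, h1⟩
  exact ⟨lam, hlam.1, hz, fun b hb => hmono.injective (hb.trans hz.symm)⟩

section Halanay

variable {ι E : Type*} [Finite ι] [NormedAddCommGroup E] [NormedSpace ℝ E]

/-- A family of curves whose norms lie below a barrier `η i * u` cannot cross the barrier on an
interval where, at each contact point with the barrier, some functional norming the curve grows
more slowly than the barrier. -/
theorem norm_lt_barrier_of_contact {ζ : ι → ℝ → E} {η : ι → ℝ} {u : ℝ → ℝ} {a c d : ℝ}
    (hζ : ∀ i, ContinuousOn (ζ i) (Icc c d)) (hu : Continuous u) (hac : a ≤ c)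
    (hinit : ∀ i, ∀ t ∈ Icc a c, ‖ζ i t‖ < η i * u t)
    (hcontact : ∀ i, ∀ t ∈ Ioc c d, ‖ζ i t‖ = η i * u t →
      (∀ j, ∀ s ∈ Ico a t, ‖ζ j s‖ < η j * u s) → (∀ j, ‖ζ j t‖ ≤ η j * u t) →
      ∃ (ψ : StrongDual ℝ E) (R : E) (u' : ℝ), ‖ψ‖ ≤ 1 ∧ ψ (ζ i t) = ‖ζ i t‖ ∧
        HasDerivAt (ζ i) R t ∧ HasDerivAt u u' t ∧ ψ R < η i * u') :
    ∀ i, ∀ t ∈ Icc a d, ‖ζ i t‖ < η i * u t := by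
  by_contra! hcon
  obtain ⟨i₀, t₀, ht₀, hle₀⟩ := hcon
  have hct₀ : c < t₀ := by
    by_contra! h
    exact (hinit i₀ t₀ ⟨ht₀.1, h⟩).not_ge hle₀
  -- `K` collects the times at which some curve reaches the barrier. It is compact, so it has a
  -- first element.
  set K : Set ℝ := ⋃ i, {t ∈ Icc c d | η i * u t ≤ ‖ζ i t‖} with hK
  have hKclosed : IsClosed K := isClosed_iUnion_of_finite fun i =>
    isClosed_Icc.isClosed_le (by fun_prop) (hζ i).norm
  have hKcpt : IsCompact K := isCompact_Icc.of_isClosed_subset hKclosed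
    (iUnion_subset fun i t ht => ht.1)
  obtain ⟨t, htK, hmin⟩ := hKcpt.exists_isLeast ⟨t₀, mem_iUnion.2 ⟨i₀, ⟨hct₀.le, ht₀.2⟩, hle₀⟩⟩
  obtain ⟨i, ⟨hct, htd⟩, hi⟩ := mem_iUnion.1 htK
  have hct : c < t := hct.lt_of_ne fun h => (hinit i t ⟨hac.trans hct, h.ge⟩).not_ge hi
  have hbefore : ∀ j, ∀ s ∈ Ico a t, ‖ζ j s‖ < η j * u s := fun j s hs => by
    rcases le_or_gt s c with hsc | hsc
    · exact hinit j s ⟨hs.1, hsc⟩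
    · by_contra! h
      exact hs.2.not_ge (hmin (mem_iUnion.2 ⟨j, ⟨hsc.le, hs.2.le.trans htd⟩, h⟩))
  have hat : ∀ j, ‖ζ j t‖ ≤ η j * u t := fun j => by
    have hIoo : Ioo c t ⊆ Icc c d := fun s hs => ⟨hs.1.le, hs.2.le.trans htd⟩
    have : (𝓝[Ioo c t] t).NeBot := by
      rw [← mem_closure_iff_nhdsWithin_neBot, closure_Ioo hct.ne]
      exact ⟨hct.le, le_rfl⟩
    refine le_of_tendsto_of_tendsto (((hζ j) t ⟨hct.le, htd⟩).mono hIoo).norm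
      ((by fun_prop : Continuous fun s => η j * u s).continuousWithinAt (s := Ioo c t) (x := t)) ?_
    filter_upwards [self_mem_nhdsWithin] with s hs
    exact (hbefore j s ⟨hac.trans hs.1.le, hs.2⟩).le
  have heq := le_antisymm (hat i) hi
  obtain ⟨ψ, R, u', hψ, hψv, hR, hu', hlt⟩ := hcontact i t ⟨hct, htd⟩ heq hbefore hat
  -- This function vanishes at the first contact and is negative before it, so its left slopes are
  -- nonnegative. That contradicts the strict inequality between the growth rates.
  have hder : HasDerivAt (fun s => ψ (ζ i s) - η i * u s) (ψ R - η i * u') t :=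
    (ψ.hasFDerivAt.comp_hasDerivAt t hR).sub (hu'.const_mul _)
  have hslope := (hder.tendsto_slope.mono_left
    (nhdsWithin_mono t (fun s (hs : s < t) => hs.ne) : 𝓝[<] t ≤ 𝓝[≠] t))
  refine (ge_of_tendsto hslope ?_).not_gt (sub_neg.2 hlt)
  filter_upwards [Ioo_mem_nhdsLT hct] with s hs
  have h1 : ψ (ζ i s) ≤ ‖ζ i s‖ := (le_abs_self _).trans
    ((ψ.le_opNorm _).trans (mul_le_of_le_one_left (norm_nonneg _) hψ))
  have h2 := hbefore i s ⟨hac.trans hs.1.le, hs.2⟩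
  rw [slope_def_field, hψv, heq, sub_self, sub_zero]
  exact div_nonneg_of_nonpos (by linarith) (by linarith [hs.2])

/-- Halanay's inequality for a finite family of curves, weighted by `η`; the differential inequality
is expressed through norming functionals and may fail on a locally finite set. -/
theorem norm_le_of_halanay {ζ : ι → ℝ → E} {η : ι → ℝ} (hη : ∀ i, 0 < η i)
    {t0 τmax σlow σbar lam M W : ℝ} (hτmax : 0 < τmax) (hσ : σlow < σbar)
    (hlam : 0 < lam) (hrate : lam - σbar + σlow * Real.exp (lam * τmax) = 0)
    (hM : 0 ≤ M) (hW : 0 ≤ W)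
    (hζ : ∀ i, ContinuousOn (ζ i) (Ici (t0 - τmax)))
    (hinit : ∀ i, ∀ t ∈ Icc (t0 - τmax) t0, ‖ζ i t‖ ≤ η i * M)
    {S : Set ℝ} (hS : ∀ b, (S ∩ Icc t0 b).Finite)
    (hode : ∀ t, t0 < t → t ∉ S → ∀ i, ∃ R, HasDerivAt (ζ i) R t ∧
      ∀ (ψ : StrongDual ℝ E) (a b : ℝ), ‖ψ‖ ≤ 1 → ψ (ζ i t) = ‖ζ i t‖ → ‖ζ i t‖ = η i * a →
        (∀ j, ‖ζ j t‖ ≤ η j * a) → (∀ j, ∀ s ∈ Ico (t - τmax) t, ‖ζ j s‖ ≤ η j * b) →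
        ψ R ≤ η i * (-σbar * a + σlow * b + W)) :
    ∀ t, t0 - τmax ≤ t → ∀ i,
      ‖ζ i t‖ ≤ η i * (M * Real.exp (-lam * (t - t0)) + W / (σbar - σlow)) := by
  have hσ' : 0 < σbar - σlow := sub_pos.2 hσ
  set u : ℝ → ℝ → ℝ := fun δ t => M * Real.exp (-lam * (t - t0)) + W / (σbar - σlow) + δ with hu
  have hucont : ∀ δ, Continuous (u δ) := fun δ => by simp only [hu]; fun_prop
  have huanti : ∀ δ, Antitone (u δ) := fun δ s t hst => by
    have : Real.exp (-lam * (t - t0)) ≤ Real.exp (-lam * (s - t0)) := by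
      rw [Real.exp_le_exp]; nlinarith
    have := mul_le_mul_of_nonneg_left this hM
    simp only [hu]; linarith
  have huderiv : ∀ δ t, HasDerivAt (u δ) (-lam * (M * Real.exp (-lam * (t - t0)))) t := fun δ t => by
    have h1 : HasDerivAt (fun s : ℝ => -lam * (s - t0)) (-lam) t := by
      simpa using ((hasDerivAt_id t).sub_const t0).const_mul (-lam)
    have h2 := ((h1.exp.const_mul M).add_const (W / (σbar - σlow))).add_const δ
    exact h2.congr_deriv (by ring)
  -- By the rate equation the barrier with `δ = 0` solves the comparison equation exactly; a slack
  -- `δ > 0` makes it a strict supersolution.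
  have hushift : ∀ δ t, -σbar * u δ t + σlow * u δ (t - τmax) + W =
      -lam * (M * Real.exp (-lam * (t - t0))) - (σbar - σlow) * δ := fun δ t => by
    have h1 : Real.exp (-lam * (t - τmax - t0)) =
        Real.exp (lam * τmax) * Real.exp (-lam * (t - t0)) := by
      rw [← Real.exp_add]; congr 1; ring
    have h2 : σlow * Real.exp (lam * τmax) = σbar - lam := by linarith
    have h3 : (σbar - σlow) * (W / (σbar - σlow)) = W := mul_div_cancel₀ _ hσ'.ne'
    simp only [hu, h1]
    linear_combination (M * Real.exp (-lam * (t - t0))) * h2 - h3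
  set P : Set ℝ := {t | ∀ i, ∀ s ∈ Icc (t0 - τmax) t, ‖ζ i s‖ ≤ η i * u 0 s} with hP
  -- Across an interval free of exceptional times, the contact argument holds for every slack `δ >
  -- 0`; letting the slack tend to zero recovers the nonstrict bound.
  have hgap : ∀ c d, t0 ≤ c → c ∈ P → (∀ t ∈ Ioc c d, t ∉ S) → d ∈ P := by
    intro c d hc hcP hfree i s hs
    refine le_of_forall_pos_le_add fun ε hε => ?_
    have hδ : 0 < ε / η i := div_pos hε (hη i)
    set δ := ε / η i
    have hstrict := norm_lt_barrier_of_contact (ζ := ζ) (η := η) (u := u δ) (a := t0 - τmax)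
      (c := c) (d := d)
      (fun j => (hζ j).mono fun t ht => mem_Ici.2 (by linarith [ht.1])) (hucont δ) (by linarith)
      (fun j t ht => (hcP j t ht).trans_lt
        (mul_lt_mul_of_pos_left (by simp only [hu]; linarith) (hη j)))
      (fun j t ht heq hbef hat => by
        obtain ⟨R, hR, hineq⟩ := hode t (hc.trans_lt ht.1) (hfree t ht) j
        obtain ⟨ψ, hψ, hψv⟩ := exists_dual_vector'' ℝ (ζ j t)
        refine ⟨ψ, R, _, hψ, hψv, hR, huderiv δ t, ?_⟩
        -- The barrier is nonincreasing, so its value at `t - τmax` dominates the whole delay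
        -- window.
        refine (hineq ψ (u δ t) (u δ (t - τmax)) hψ hψv heq hat fun k s hs => ?_).trans_lt ?_
        · exact (hbef k s ⟨by linarith [hs.1, ht.1], hs.2⟩).le.trans
            (mul_le_mul_of_nonneg_left (huanti δ hs.1) (hη k).le)
        · rw [hushift]
          exact mul_lt_mul_of_pos_left (by nlinarith) (hη j))
      i s hs
    refine hstrict.le.trans (le_of_eq ?_)
    have : η i * δ = ε := mul_div_cancel₀ _ (hη i).ne'
    simp only [hu]
    linear_combination this
  have hPt0 : t0 ∈ P := fun i s hs => (hinit i s hs).trans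
    (mul_le_mul_of_nonneg_left (by
      have h1 : (1 : ℝ) ≤ Real.exp (-lam * (s - t0)) := Real.one_le_exp (by nlinarith [hs.2])
      have h2 : 0 ≤ W / (σbar - σlow) := by positivity
      simp only [hu]; nlinarith) (hη i).le)
  have hPIcc : ∀ b, t0 ≤ b → b ∈ P := by
    intro b hb
    -- Continuous induction on `[t0, b]`: the good set is closed, and local finiteness of `S` leaves
    -- an interval to the right of each `c` free of exceptional times. The point `c` itself may lie
    -- in `S`, since `hgap` concerns only later times.
    have hclosed : IsClosed (P ∩ Icc t0 b) := by
      refine isClosed_of_closure_subset fun t ht => ?_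
      have htI : t ∈ Icc t0 b :=
        isClosed_Icc.closure_subset_iff.2 inter_subset_right ht
      refine ⟨fun i s hs => ?_, htI⟩
      rcases hs.2.lt_or_eq with hlt | rfl
      · obtain ⟨t', ht', hst'⟩ := mem_closure_iff.1 ht (Ioi s) isOpen_Ioi hlt
        exact hst'.1 i s ⟨hs.1, le_of_lt ht'⟩
      · have hsub : P ∩ Icc t0 b ⊆ Ici (t0 - τmax) := fun r hr => mem_Ici.2 (by linarith [hr.2.1])
        have : (𝓝[P ∩ Icc t0 b] s).NeBot := mem_closure_iff_nhdsWithin_neBot.1 ht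
        refine le_of_tendsto_of_tendsto (((hζ i) s hs.1).mono hsub).norm
          ((continuous_const.mul (hucont 0)).continuousWithinAt (s := P ∩ Icc t0 b) (x := s)) ?_
        filter_upwards [self_mem_nhdsWithin] with r hr
        exact hr.1 i r ⟨hsub hr, le_rfl⟩
    refine hclosed.mem_of_ge_of_forall_exists_gt hPt0 hb fun c hc => ?_
    have hfin : ((S ∩ Icc t0 b) \ {c}).Finite := (hS b).sdiff
    have hnhds : ((S ∩ Icc t0 b) \ {c})ᶜ ∈ 𝓝 c := hfin.isClosed.isOpen_compl.mem_nhds (by simp)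
    obtain ⟨e, he, hsub⟩ := exists_Ico_subset_of_mem_nhds hnhds ⟨b, hc.2.2⟩
    have hd : c < min b ((c + e) / 2) := lt_min hc.2.2 (by linarith)
    refine ⟨min b ((c + e) / 2), hgap c _ hc.2.1 hc.1 fun t ht htS => ?_, hd, min_le_left _ _⟩
    have h1 : t ≤ b := ht.2.trans (min_le_left _ _)
    have h2 : t ≤ (c + e) / 2 := ht.2.trans (min_le_right _ _)
    exact hsub ⟨ht.1.le, by linarith⟩ ⟨⟨htS, hc.2.1.trans ht.1.le, h1⟩, ht.1.ne'⟩
  intro t ht i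
  have := hPIcc (max t t0) (le_max_right _ _) i t ⟨ht, le_max_left _ _⟩
  simpa only [hu, add_zero] using this

end Halanay

/-! ### Derivatives of the polynomial disturbance -/

namespace MultiplexNetwork

variable {N n o l m q : ℕ}

/-- The `k`-th derivative of the polynomial disturbance of degree less than `m`. -/
def polyDisturbanceDeriv (m : ℕ) (dbar : ℕ → Fin N → Fin n → ℝ) (k : ℕ) (i : Fin N) (s : ℝ) :
    Fin n → ℝ :=
  ∑ j ∈ Finset.range m, ((j.descFactorial k : ℝ) * s ^ (j - k)) • dbar j i

theorem polyDisturbanceDeriv_zero (dbar : ℕ → Fin N → Fin n → ℝ) (i : Fin N) :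
    polyDisturbanceDeriv m dbar 0 i = polyDisturbance m dbar i := by
  funext s; simp [polyDisturbanceDeriv, polyDisturbance]

/-- The degree is below `m`; this is why `m` integrators suffice to cancel the polynomial
disturbance. -/
theorem polyDisturbanceDeriv_self (dbar : ℕ → Fin N → Fin n → ℝ) (i : Fin N) (s : ℝ) :
    polyDisturbanceDeriv m dbar m i s = 0 :=
  Finset.sum_eq_zero fun j hj => by
    simp [Nat.descFactorial_of_lt (Finset.mem_range.1 hj)]

theorem hasDerivAt_polyDisturbanceDeriv (dbar : ℕ → Fin N → Fin n → ℝ) (k : ℕ) (i : Fin N)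
    (s : ℝ) :
    HasDerivAt (polyDisturbanceDeriv m dbar k i) (polyDisturbanceDeriv m dbar (k + 1) i s) s := by
  unfold polyDisturbanceDeriv
  refine HasDerivAt.fun_sum fun j _ => ?_
  refine (((hasDerivAt_pow (j - k) s).const_mul (j.descFactorial k : ℝ)).smul_const
    (dbar j i)).congr_deriv ?_
  -- Truncated subtraction is harmless: for `j ≤ k` the factor `j - k` is zero on both sides.
  rw [Nat.descFactorial_succ, Nat.cast_mul, Nat.sub_sub]
  congr 1
  ring

theorem iteratedDeriv_polyDisturbance (dbar : ℕ → Fin N → Fin n → ℝ) (k : ℕ) (i : Fin N) :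
    iteratedDeriv k (polyDisturbance m dbar i) = polyDisturbanceDeriv m dbar k i := by
  induction k with
  | zero => rw [iteratedDeriv_zero, polyDisturbanceDeriv_zero]
  | succ k ih =>
    rw [iteratedDeriv_succ, ih]
    exact funext fun s => (hasDerivAt_polyDisturbanceDeriv dbar k i s).deriv

/-- The index `b` counts down from the top degree through `j = m - 1 - b`, the factorial quotient is
a descending factorial, and the terms with `j < k` vanish. -/
theorem shiftedIntegrator_eq (dbar : ℕ → Fin N → Fin n → ℝ)
    (r : ℝ → Fin m → Fin N → Fin n → ℝ) (k : Fin m) (s : ℝ) (i : Fin N) :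
    shiftedIntegrator dbar r k s i = r s k i + polyDisturbanceDeriv m dbar k i s := by
  rw [shiftedIntegrator, add_comm, polyDisturbanceDeriv]
  congr 1
  conv_rhs => rw [← Finset.sum_range_reflect]
  have hk := k.2
  rw [show m - ((k : ℕ) + 1) + 1 = m - k by omega]
  rw [← Finset.sum_subset (Finset.range_subset_range.2 (Nat.sub_le m k)) fun b hb hb' => ?_]
  · refine Finset.sum_congr rfl fun b hb => ?_
    have hb := Finset.mem_range.1 hb
    have hle : (k : ℕ) ≤ m - 1 - b := by omega
    rw [show m - ((k : ℕ) + 1) - b = m - 1 - b - k by omega]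
    congr 2
    rw [div_eq_iff (by positivity), mul_comm]
    exact_mod_cast (Nat.factorial_mul_descFactorial hle).symm
  · have hb := Finset.mem_range.1 hb
    rw [Finset.mem_range] at hb'
    simp [Nat.descFactorial_of_lt (show m - 1 - b < k by omega)]

end MultiplexNetwork

/-! ### The closed-loop vector field and its Jacobian blocks -/

namespace MultiplexNetwork

variable {N n o l m q : ℕ}

theorem jacobian_mulVec (F : (Fin n → ℝ) → (Fin n → ℝ)) (v u : Fin n → ℝ) :
    (jacobian F v).mulVec u = fderiv ℝ F v u := by
  rw [jacobian, LinearMap.toMatrix'_mulVec]; rfl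

theorem jacobian_comp_mulVec {E : Type*} [NormedAddCommGroup E] [NormedSpace ℝ E]
    {F : E → Fin n → ℝ} {G : (Fin n → ℝ) → E} {F' : E →L[ℝ] (Fin n → ℝ)}
    {G' : (Fin n → ℝ) →L[ℝ] E} {v : Fin n → ℝ} (hF : HasFDerivAt F F' (G v))
    (hG : HasFDerivAt G G' v) (u : Fin n → ℝ) :
    (jacobian (fun v => F (G v)) v).mulVec u = F' (G' u) := by
  rw [jacobian_mulVec]
  exact DFunLike.congr_fun (hF.comp v hG).fderiv u

/-- The total derivative is the sum of its partial derivatives, by splitting `e` into its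
single-agent components. -/
theorem sum_jacobian_update_mulVec {F : (Fin N → Fin n → ℝ) → Fin n → ℝ}
    {X : Fin N → Fin n → ℝ} (hF : DifferentiableAt ℝ F X) (e : Fin N → Fin n → ℝ) :
    ∑ j, (jacobian (fun v => F (Function.update X j v)) (X j)).mulVec (e j) = fderiv ℝ F X e := by
  have h : ∀ j, (jacobian (fun v => F (Function.update X j v)) (X j)).mulVec (e j) =
      fderiv ℝ F X (Pi.single j (e j)) := fun j => by
    rw [jacobian_comp_mulVec (by simpa using hF.hasFDerivAt) (hasFDerivAt_update X (X j))]
    congr 1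
    funext j'
    rcases eq_or_ne j' j with rfl | hj <;> simp [*]
  simp_rw [h]
  rw [← map_sum, Finset.univ_sum_single]

theorem sum_sum_jacobian_update_mulVec {F : (Fin q → Fin N → Fin n → ℝ) → Fin n → ℝ}
    {Ξ : Fin q → Fin N → Fin n → ℝ} (hF : DifferentiableAt ℝ F Ξ)
    (ε : Fin q → Fin N → Fin n → ℝ) :
    ∑ κ, ∑ j, (jacobian (fun v => F (Function.update Ξ κ (Function.update (Ξ κ) j v)))
      (Ξ κ j)).mulVec (ε κ j) = fderiv ℝ F Ξ ε := by
  have h : ∀ κ, ∑ j, (jacobian (fun v => F (Function.update Ξ κ (Function.update (Ξ κ) j v)))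
      (Ξ κ j)).mulVec (ε κ j) = fderiv ℝ F Ξ (Pi.single κ (ε κ)) := fun κ => by
    have hG := hasFDerivAt_update (𝕜 := ℝ) Ξ (i := κ) (Ξ κ)
    have hFG : HasFDerivAt (fun v => F (Function.update Ξ κ v)) _ (Ξ κ) :=
      HasFDerivAt.comp (g := F) (g' := fderiv ℝ F Ξ) (Ξ κ) (by simpa using hF.hasFDerivAt) hG
    rw [sum_jacobian_update_mulVec (F := fun v => F (Function.update Ξ κ v))
      hFG.differentiableAt, hFG.fderiv, ContinuousLinearMap.comp_apply]
    congr 1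
    funext κ'
    rcases eq_or_ne κ' κ with rfl | hκ <;> simp [*]
  simp_rw [h]
  rw [← map_sum, Finset.univ_sum_single]

theorem firstColumn_mulVec (C : Fin (m + 1) → Matrix (Fin n) (Fin n) ℝ)
    (z : Fin (m + 1) × Fin n → ℝ) (a : Fin (m + 1) × Fin n) :
    (firstColumn C).mulVec z a = (C a.1).mulVec (fun b => z (0, b)) a.2 := by
  simp only [firstColumn, Matrix.mulVec, dotProduct, Matrix.of_apply, Fintype.sum_prod_type,
    ite_mul, zero_mul]
  rw [Finset.sum_eq_single 0 (fun k _ hk => by simp [hk]) (by simp)]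
  simp

theorem shiftBlocks_mulVec (z : Fin (m + 1) × Fin n → ℝ) (k : Fin (m + 1)) (b : Fin n) :
    (shiftBlocks m n).mulVec z (k, b) =
      if hk : (k : ℕ) < m then z (Fin.succ ⟨k, hk⟩, b) else 0 := by
  simp only [shiftBlocks, Matrix.mulVec, dotProduct, Matrix.of_apply, ite_mul, one_mul, zero_mul]
  split_ifs with hk
  · rw [Finset.sum_eq_single (Fin.succ ⟨k, hk⟩, b)]
    · simp
    · rintro ⟨k', b'⟩ - hne
      refine if_neg fun h => hne ?_
      exact Prod.ext (Fin.ext h.1) h.2.symm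
    · simp
  · refine Finset.sum_eq_zero fun a _ => if_neg fun h => ?_
    have := a.1.2
    omega

/-- Isolating the intrinsic and shift terms lets the coupling Jacobians be summed over all `j`
uniformly. -/
theorem blockA_eq (net : MultiplexNetwork N n o l m q) (i j : Fin N) (x : Fin N → Fin n → ℝ)
    (xl : Fin l → ℝ) (t : ℝ) :
    net.blockA i j x xl t = firstColumn (fun k => net.dh i j k x xl t) +
      if j = i then firstColumn (fun k =>
        if k = 0 then jacobian (fun v => net.f i v t) (x i) else 0) + shiftBlocks m n else 0 := by
  unfold blockA
  split_ifs with h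
  · subst h
    ext a b
    by_cases hb : b.1 = 0
    · by_cases ha : a.1 = 0
      · simp only [firstColumn, Matrix.add_apply, Matrix.of_apply, hb, ha, if_true]
        ring
      · simp [firstColumn, hb, ha]
    · simp [firstColumn, hb]
  · rw [add_zero]

/-- The right-hand side of the stacked error dynamics of agent `i`, without disturbance, at states
`X`, delayed states `Ξ` and stacked state `z`. -/
noncomputable def stackedField (net : MultiplexNetwork N n o l m q) (i : Fin N) (t : ℝ)
    (v : Fin l → ℝ) (ζ : Fin q → Fin l → ℝ) (X : Fin N → Fin n → ℝ)
    (Ξ : Fin q → Fin N → Fin n → ℝ) (z : Fin (m + 1) × Fin n → ℝ) : Fin (m + 1) × Fin n → ℝ :=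
  fun a => ((if a.1 = 0 then net.f i (X i) t else 0) + net.h i a.1 X v t +
    net.hDelayed i a.1 Ξ ζ t) a.2 + (shiftBlocks m n).mulVec z a

/-- Chain rule along a segment. Only block `0` of each stacked vector moves the agent states, whence
the first-column shape of the Jacobian blocks; the other blocks enter linearly through the shift. -/
theorem hasDerivAt_stackedField {net : MultiplexNetwork N n o l m q} (hnet : net.IsSmooth)
    (i : Fin N) (t : ℝ) (v : Fin l → ℝ) (ζ : Fin q → Fin l → ℝ) (X : Fin N → Fin n → ℝ)
    (Ξ : Fin q → Fin N → Fin n → ℝ) (z : Fin N → Fin (m + 1) × Fin n → ℝ)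
    (zd : Fin q → Fin N → Fin (m + 1) × Fin n → ℝ) (s : ℝ) :
    HasDerivAt (fun s : ℝ => net.stackedField i t v ζ (X + s • fun j b => z j (0, b))
        (Ξ + s • fun κ j b => zd κ j (0, b)) (s • z i))
      (∑ j, (net.blockA i j (X + s • fun j b => z j (0, b)) v t).mulVec (z j) +
        ∑ κ, ∑ j, (net.blockB κ i j (Ξ + s • fun κ j b => zd κ j (0, b)) ζ t).mulVec (zd κ j))
      s := by
  set e : Fin N → Fin n → ℝ := fun j b => z j (0, b)
  set ε : Fin q → Fin N → Fin n → ℝ := fun κ j b => zd κ j (0, b)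
  have hX : HasDerivAt (fun s : ℝ => X + s • e) e s := by
    simpa using ((hasDerivAt_id s).smul_const e).const_add X
  have hΞ : HasDerivAt (fun s : ℝ => Ξ + s • ε) ε s := by
    simpa using ((hasDerivAt_id s).smul_const ε).const_add Ξ
  have hz : HasDerivAt (fun s : ℝ => s • z i) (z i) s := by
    simpa using (hasDerivAt_id s).smul_const (z i)
  have hf : Differentiable ℝ fun u => net.f i u t :=
    ((hnet.1 i).comp (contDiff_id.prodMk contDiff_const)).differentiable one_ne_zero
  have hh : ∀ k, Differentiable ℝ fun Y => net.h i k Y v t := fun k =>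
    ((hnet.2.1 i k).comp (contDiff_id.prodMk (contDiff_const (c := (v, t))))).differentiable one_ne_zero
  have hd : ∀ k, Differentiable ℝ fun Y => net.hDelayed i k Y ζ t := fun k =>
    ((hnet.2.2 i k).comp (contDiff_id.prodMk (contDiff_const (c := (ζ, t))))).differentiable one_ne_zero
  rw [hasDerivAt_pi]
  rintro ⟨k, b⟩
  have h1 : HasDerivAt (fun s : ℝ => if k = 0 then net.f i ((X + s • e) i) t else 0)
      ((if k = 0 then jacobian (fun u => net.f i u t) ((X + s • e) i) else 0).mulVec (e i)) s := by
    split_ifs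
    · rw [jacobian_mulVec]
      exact (hf _).hasFDerivAt.comp_hasDerivAt s (hasDerivAt_pi.1 hX i)
    · simpa using hasDerivAt_const s (0 : Fin n → ℝ)
  have h2 : HasDerivAt (fun s : ℝ => net.h i k (X + s • e) v t)
      (∑ j, (net.dh i j k (X + s • e) v t).mulVec (e j)) s := by
    unfold dh
    rw [sum_jacobian_update_mulVec (hh k _)]
    exact (hh k _).hasFDerivAt.comp_hasDerivAt s hX
  have h3 : HasDerivAt (fun s : ℝ => net.hDelayed i k (Ξ + s • ε) ζ t)
      (∑ κ, ∑ j, (net.dhDelayed κ i j k (Ξ + s • ε) ζ t).mulVec (ε κ j)) s := by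
    unfold dhDelayed
    rw [sum_sum_jacobian_update_mulVec (hd k _)]
    exact (hd k _).hasFDerivAt.comp_hasDerivAt s hΞ
  have h4 : HasDerivAt (fun s : ℝ => (shiftBlocks m n).mulVec (s • z i))
      ((shiftBlocks m n).mulVec (z i)) s := by
    simp only [Matrix.mulVec_smul]
    simpa using (hasDerivAt_id s).smul_const ((shiftBlocks m n).mulVec (z i))
  refine ((hasDerivAt_pi.1 ((h1.add h2).add h3) b).add (hasDerivAt_pi.1 h4 (k, b))).congr_deriv ?_
  simp only [Pi.add_apply, Finset.sum_apply, blockA_eq, blockB, Matrix.add_mulVec,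
    firstColumn_mulVec, Finset.sum_add_distrib]
  have h5 : ∀ M : Matrix (Fin (m + 1) × Fin n) (Fin (m + 1) × Fin n) ℝ,
      ∑ j, (if j = i then M else 0).mulVec (z j) (k, b) = M.mulVec (z i) (k, b) := fun M => by
    rw [Finset.sum_eq_single i (fun j _ hj => by simp [hj]) (by simp), if_pos rfl]
  simp only [h5, Matrix.add_mulVec, Pi.add_apply, firstColumn_mulVec]
  ring

theorem dual_stackedField_sub_le {net : MultiplexNetwork N n o l m q} (hnet : net.IsSmooth)
    {p : ℝ≥0∞} [Fact (1 ≤ p)] {η : Fin N → ℝ} (hη : ∀ i, 0 < η i)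
    {T : Fin N → Matrix (Fin (m + 1) × Fin n) (Fin (m + 1) × Fin n) ℝ} (hT : ∀ i, IsUnit (T i))
    {t0 σlow σbar : ℝ} (hC2 : net.CondC2 p η T t0 σbar) (hC3 : net.CondC3 p η T t0 σlow)
    {t : ℝ} (ht : t0 ≤ t) (xl : ℝ → Fin l → ℝ) (y : ℝ → Fin N → Fin n → ℝ)
    (z : ℝ → Fin N → Fin (m + 1) × Fin n → ℝ) (i : Fin N)
    {ψ : StrongDual ℝ (PiLp p fun _ : Fin (m + 1) × Fin n => ℝ)} (hψ : ‖ψ‖ ≤ 1)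
    {a b : ℝ} (hb : 0 ≤ b)
    (hψz : ψ (WithLp.toLp p ((T i).mulVec (z t i))) = lpNorm p ((T i).mulVec (z t i)))
    (hi : lpNorm p ((T i).mulVec (z t i)) = η i * a)
    (ha : ∀ j, lpNorm p ((T j).mulVec (z t j)) ≤ η j * a)
    (hdel : ∀ κ j, lpNorm p ((T j).mulVec (z (t - net.τ κ t) j)) ≤ η j * b) :
    ψ (WithLp.toLp p ((T i).mulVec
      (net.stackedField i t (xl t) (fun κ => xl (t - net.τ κ t)) (y t + fun j b => z t j (0, b))
          (fun κ => y (t - net.τ κ t) + fun j b => z (t - net.τ κ t) j (0, b)) (z t i) -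
        net.stackedField i t (xl t) (fun κ => xl (t - net.τ κ t)) (y t)
          (fun κ => y (t - net.τ κ t)) 0))) ≤ η i * (-σbar * a + σlow * b) := by
  have ha0 : 0 ≤ a := nonneg_of_mul_nonneg_right (hi ▸ lpNorm_nonneg _) (hη i)
  let Λ : (Fin (m + 1) × Fin n → ℝ) →L[ℝ] ℝ := LinearMap.toContinuousLinearMap
    (ψ.toLinearMap ∘ₗ (WithLp.linearEquiv p ℝ (Fin (m + 1) × Fin n → ℝ)).symm.toLinearMap ∘ₗ
      (T i).mulVecLin)
  have hΛ : ∀ u, Λ u = ψ (WithLp.toLp p ((T i).mulVec u)) := fun u => rfl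
  have hder := fun s => Λ.hasFDerivAt.comp_hasDerivAt s (hasDerivAt_stackedField hnet i t (xl t)
    (fun κ => xl (t - net.τ κ t)) (y t) (fun κ => y (t - net.τ κ t)) (z t)
    (fun κ => z (t - net.τ κ t)) s)
  -- Since `ψ` makes the function scalar, the mean value theorem yields one `s` common to all
  -- Jacobian blocks, and no averaged matrices arise.
  obtain ⟨s, -, hs⟩ := exists_hasDerivAt_eq_slope _ _ one_pos
    (fun s _ => (hder s).continuousAt.continuousWithinAt) (fun s _ => hder s)
  have h2 := hC2 t ht (y t + s • fun j b => z t j (0, b)) (xl t) i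
  -- C3 quantifies over signals, so the intermediate delayed states are realised as values of one
  -- interpolated signal with `s` held fixed.
  have h3 := hC3 t ht (fun r => y r + s • fun j b => z r j (0, b)) xl i
  have hconj : ∀ (M : Matrix (Fin (m + 1) × Fin n) (Fin (m + 1) × Fin n) ℝ) (j : Fin N)
      (u : Fin (m + 1) × Fin n → ℝ),
      Λ (M.mulVec u) = ψ (WithLp.toLp p ((T i * M * (T j)⁻¹).mulVec ((T j).mulVec u))) := by
    intro M j u
    rw [hΛ, Matrix.mulVec_mulVec, Matrix.mulVec_mulVec, Matrix.mul_assoc (T i * M),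
      Matrix.nonsing_inv_mul _ ((Matrix.isUnit_iff_isUnit_det _).1 (hT j)), Matrix.mul_one]
  have hcancel : ∀ j, η j = η i * (η j / η i) := fun j => (mul_div_cancel₀ _ (hη i).ne').symm
  -- The matrix measure is available only for the diagonal block, where `ψ` norms the vector; the
  -- other blocks cost their operator norms.
  have hA : Λ (∑ j, (net.blockA i j (y t + s • fun j b => z t j (0, b)) (xl t) t).mulVec (z t j)) ≤
      η i * (-σbar * a) := by
    rw [map_sum, ← Finset.add_sum_erase _ _ (Finset.mem_univ i)]
    calc _ ≤ matrixMeasure p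
            (T i * net.blockA i i (y t + s • fun j b => z t j (0, b)) (xl t) t * (T i)⁻¹) *
            (η i * a) + ∑ j ∈ Finset.univ.erase i, lpOpNorm p
              (T i * net.blockA i j (y t + s • fun j b => z t j (0, b)) (xl t) t * (T j)⁻¹) *
              (η j * a) := by
          refine add_le_add ?_ (Finset.sum_le_sum fun j _ => ?_)
          · rw [hconj _ i, ← hi]
            exact dual_mulVec_le_matrixMeasure hψ hψz _
          · rw [hconj _ j]
            exact (dual_mulVec_le_lpOpNorm hψ _ _).trans
              (mul_le_mul_of_nonneg_left (ha j) (lpOpNorm_nonneg _))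
      _ = η i * a * (matrixMeasure p
            (T i * net.blockA i i (y t + s • fun j b => z t j (0, b)) (xl t) t * (T i)⁻¹) +
            ∑ j ∈ Finset.univ.erase i, η j / η i * lpOpNorm p
              (T i * net.blockA i j (y t + s • fun j b => z t j (0, b)) (xl t) t * (T j)⁻¹)) := by
          rw [mul_add, Finset.mul_sum]
          congr 1
          · ring
          · refine Finset.sum_congr rfl fun j _ => ?_
            conv_lhs => rw [hcancel j]
            ring
      _ ≤ η i * a * (-σbar) := mul_le_mul_of_nonneg_left h2 (mul_nonneg (hη i).le ha0)
      _ = _ := by ring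
  have hB : Λ (∑ κ, ∑ j, (net.blockB κ i j ((fun κ => y (t - net.τ κ t)) +
      s • fun κ j b => z (t - net.τ κ t) j (0, b)) (fun κ => xl (t - net.τ κ t)) t).mulVec
        (z (t - net.τ κ t) j)) ≤ η i * (σlow * b) := by
    simp only [map_sum]
    calc _ ≤ ∑ κ, ∑ j, lpOpNorm p (T i * net.blockB κ i j ((fun κ => y (t - net.τ κ t)) +
            s • fun κ j b => z (t - net.τ κ t) j (0, b)) (fun κ => xl (t - net.τ κ t)) t *
              (T j)⁻¹) * (η j * b) := by
          refine Finset.sum_le_sum fun κ _ => Finset.sum_le_sum fun j _ => ?_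
          rw [hconj _ j]
          exact (dual_mulVec_le_lpOpNorm hψ _ _).trans
            (mul_le_mul_of_nonneg_left (hdel κ j) (lpOpNorm_nonneg _))
      _ = η i * b * ∑ κ, ∑ j, η j / η i * lpOpNorm p (T i * net.blockB κ i j
            ((fun κ => y (t - net.τ κ t)) + s • fun κ j b => z (t - net.τ κ t) j (0, b))
            (fun κ => xl (t - net.τ κ t)) t * (T j)⁻¹) := by
          simp only [Finset.mul_sum]
          refine Finset.sum_congr rfl fun κ _ => Finset.sum_congr rfl fun j _ => ?_
          conv_lhs => rw [hcancel j]
          ring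
      _ ≤ η i * b * σlow := mul_le_mul_of_nonneg_left h3 (mul_nonneg (hη i).le hb)
      _ = _ := by ring
  have hfinal := add_le_add hA hB
  rw [← map_add, hs] at hfinal
  simp only [sub_zero, div_one, Function.comp_apply, one_smul, zero_smul, add_zero] at hfinal
  rw [← map_sub, hΛ] at hfinal
  rw [mul_add]
  exact hfinal

end MultiplexNetwork

/-! ### The stacked error system and its decay estimate -/

theorem lpNorm_le_sum_blocks {ι κ : Type*} [Fintype ι] [Fintype κ] [DecidableEq κ] {p : ℝ≥0∞}
    [Fact (1 ≤ p)] (z : κ × ι → ℝ) : lpNorm p z ≤ ∑ k, lpNorm p fun b => z (k, b) := by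
  set Z : κ → κ × ι → ℝ := fun k a => if a.1 = k then z a else 0
  have hz : z = ∑ k, Z k := by
    funext a
    simp [Z, Finset.sum_apply]
  have h1 : lpNorm p z ≤ ∑ k, lpNorm p (Z k) := by
    conv_lhs => rw [hz]
    simp only [lpNorm, WithLp.toLp_sum]
    exact norm_sum_le _ _
  refine h1.trans (Finset.sum_le_sum fun k _ => ?_)
  refine (lpNorm_le_comp (Prod.mk_right_injective k) fun a ha => ?_).trans (le_of_eq ?_)
  · exact if_neg fun h => ha ⟨a.2, Prod.ext h.symm rfl⟩
  · congr 1
    funext b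
    simp [Z]

theorem ContinuousOn.bddAbove_range_Icc {f : ℝ → ℝ} {a b : ℝ} (hf : ContinuousOn f (Icc a b)) :
    BddAbove (range fun s : Icc a b => f s) := by
  have := isCompact_Icc.bddAbove_image hf
  rwa [← range_domRestrict] at this

namespace MultiplexNetwork

variable {N n o l m q : ℕ}

/-- The state of the error system of agent `i`: the deviation from the desired solution, stacked on
top of the shifted integrator states. -/
noncomputable def stackedError (xs : ℝ → Fin N → Fin n → ℝ) (dbar : ℕ → Fin N → Fin n → ℝ)
    (x : ℝ → Fin N → Fin n → ℝ) (r : ℝ → Fin m → Fin N → Fin n → ℝ) (t : ℝ) (i : Fin N) :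
    Fin (m + 1) × Fin n → ℝ :=
  fun a => (Fin.cases (x t i - xs t i) (fun k => shiftedIntegrator dbar r k t i) a.1 :
    Fin n → ℝ) a.2

/-- The residual disturbance, entering the top layer of the error system. -/
noncomputable def stackedDisturbance (m : ℕ) (v : Fin N → Fin n → ℝ) (i : Fin N) :
    Fin (m + 1) × Fin n → ℝ :=
  fun a => if a.1 = 0 then v i a.2 else 0

section

variable {xs x : ℝ → Fin N → Fin n → ℝ} {dbar : ℕ → Fin N → Fin n → ℝ}
  {r : ℝ → Fin m → Fin N → Fin n → ℝ} {p : ℝ≥0∞} [Fact (1 ≤ p)] {η : Fin N → ℝ}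

theorem stackedError_zero (t : ℝ) (i : Fin N) :
    (fun b => stackedError xs dbar x r t i (0, b)) = x t i - xs t i := rfl

theorem stackedError_succ (t : ℝ) (i : Fin N) (k : Fin m) :
    (fun b => stackedError xs dbar x r t i (k.succ, b)) = shiftedIntegrator dbar r k t i := rfl

theorem cmpstNorm_sub_le_stackedError (hη : ∀ i, 0 < η i) (t : ℝ) :
    cmpstNorm p η (x t - xs t) ≤ cmpstNorm p η (stackedError xs dbar x r t) :=
  cmpstNorm_le hη (cmpstNorm_nonneg hη _) fun i =>
    (lpNorm_comp_le (Prod.mk_right_injective (0 : Fin (m + 1)))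
      (stackedError xs dbar x r t i)).trans (lpNorm_le_mul_cmpstNorm hη _ i)

theorem cmpstNorm_stackedError_le (hη : ∀ i, 0 < η i) (t : ℝ) :
    cmpstNorm p η (stackedError xs dbar x r t) ≤ cmpstNorm p η (x t - xs t) +
      ∑ k : Fin m, cmpstNorm p η (shiftedIntegrator dbar r k t) := by
  refine cmpstNorm_le hη (add_nonneg (cmpstNorm_nonneg hη _)
    (Finset.sum_nonneg fun k _ => cmpstNorm_nonneg hη _)) fun i => ?_
  refine (lpNorm_le_sum_blocks _).trans ?_
  rw [Fin.sum_univ_succ, mul_add, Finset.mul_sum]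
  refine add_le_add ?_ (Finset.sum_le_sum fun k _ => ?_)
  · rw [stackedError_zero]
    exact lpNorm_le_mul_cmpstNorm hη (x t - xs t) i
  · rw [stackedError_succ]
    exact lpNorm_le_mul_cmpstNorm hη (shiftedIntegrator dbar r k t) i

theorem cmpstNorm_stackedDisturbance_le (hη : ∀ i, 0 < η i) (v : Fin N → Fin n → ℝ) :
    cmpstNorm p η (stackedDisturbance m v) ≤ cmpstNorm p η v := by
  refine cmpstNorm_le hη (cmpstNorm_nonneg hη _) fun i => ?_
  refine (lpNorm_le_comp (Prod.mk_right_injective (0 : Fin (m + 1))) fun a ha => ?_).trans ?_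
  · exact if_neg fun h => ha ⟨a.2, Prod.ext h.symm rfl⟩
  · exact lpNorm_le_mul_cmpstNorm hη v i

theorem continuousOn_shiftedIntegrator {A : Set ℝ} (hr : ContinuousOn r A) (k : Fin m)
    (i : Fin N) : ContinuousOn (fun t => shiftedIntegrator dbar r k t i) A := by
  simp only [shiftedIntegrator_eq]
  refine ContinuousOn.add ?_ fun s _ =>
    (hasDerivAt_polyDisturbanceDeriv dbar k i s).continuousAt.continuousWithinAt
  exact continuousOn_pi.1 (continuousOn_pi.1 hr k) i

theorem continuousOn_stackedError {A : Set ℝ} (hxs : ContinuousOn xs A) (hx : ContinuousOn x A)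
    (hr : ContinuousOn r A) (i : Fin N) :
    ContinuousOn (fun t => stackedError xs dbar x r t i) A := by
  refine continuousOn_pi.2 fun ⟨k, b⟩ => ?_
  cases k using Fin.cases with
  | zero => exact continuousOn_pi.1 ((continuousOn_pi.1 hx i).sub (continuousOn_pi.1 hxs i)) b
  | succ k => exact continuousOn_pi.1 (continuousOn_shiftedIntegrator hr k i) b

/-- The shift feeds layer `k` with the integrator above it together with the `k`-th derivative of
the disturbance. At `k = m` both are absent, the derivative being zero. -/
theorem shiftBlocks_mulVec_stackedError (t : ℝ) (i : Fin N) (k : Fin (m + 1)) (b : Fin n) :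
    (shiftBlocks m n).mulVec (stackedError xs dbar x r t i) (k, b) =
      ((if hk : (k : ℕ) < m then r t ⟨k, hk⟩ i else 0) + polyDisturbanceDeriv m dbar k i t) b := by
  rw [shiftBlocks_mulVec]
  split_ifs with hk
  · exact congrFun (shiftedIntegrator_eq dbar r ⟨k, hk⟩ t i) b
  · rw [show (k : ℕ) = m by omega, polyDisturbanceDeriv_self]
    simp

/-- By C1 the field along `xs` reduces to the intrinsic dynamics in block `0`. The shift term
accounts for the polynomial disturbance and its derivatives, so only `w` remains as input. -/
theorem hasDerivAt_stackedError {net : MultiplexNetwork N n o l m q} {t0 τmax : ℝ}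
    {xl : ℝ → Fin l → ℝ} (hxs : net.IsDesiredSolution t0 τmax xs) (hC1 : net.CondC1 t0 xl xs)
    {w : ℝ → Fin N → Fin n → ℝ} {t : ℝ} (ht : t0 < t)
    (hx : ∀ i, HasDerivAt (fun s => x s i) (net.f i (x t i) t + net.layerSignal xl x r i 0 t +
      (w t i + polyDisturbance m dbar i t)) t)
    (hr : ∀ (k : Fin m) (i : Fin N), HasDerivAt (fun s => r s k i)
      (net.layerSignal xl x r i k.succ t) t) (i : Fin N) :
    HasDerivAt (fun s => stackedError xs dbar x r s i)
      (net.stackedField i t (xl t) (fun κ => xl (t - net.τ κ t)) (x t)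
          (fun κ => x (t - net.τ κ t)) (stackedError xs dbar x r t i) -
        net.stackedField i t (xl t) (fun κ => xl (t - net.τ κ t)) (xs t)
          (fun κ => xs (t - net.τ κ t)) 0 + stackedDisturbance m (w t) i) t := by
  have hxs' : HasDerivAt (fun s => xs s i) (net.f i (xs t i) t) t :=
    (hxs.2 t ht.le i).hasDerivAt (Ici_mem_nhds ht)
  refine hasDerivAt_pi.2 fun ⟨k, b⟩ => ?_
  have h1 := hC1 t ht.le i k
  have h0 : net.stackedField i t (xl t) (fun κ => xl (t - net.τ κ t)) (xs t)
      (fun κ => xs (t - net.τ κ t)) 0 (k, b) = (if k = 0 then net.f i (xs t i) t else 0) b := by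
    simp [stackedField, h1.1, h1.2]
  rw [Pi.add_apply, Pi.sub_apply, h0]
  simp only [stackedField, shiftBlocks_mulVec_stackedError]
  cases k using Fin.cases with
  | zero =>
    refine (hasDerivAt_pi.1 ((hx i).sub hxs') b).congr_deriv ?_
    simp only [Fin.val_zero, polyDisturbanceDeriv_zero, stackedDisturbance, layerSignal, coupling,
      if_true, Pi.add_apply, Pi.sub_apply]
    ring
  | succ k =>
    have h2 : HasDerivAt (fun s => shiftedIntegrator dbar r k s i)
        (net.layerSignal xl x r i k.succ t + polyDisturbanceDeriv m dbar (k + 1) i t) t := by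
      simp only [shiftedIntegrator_eq]
      exact (hr k i).add (hasDerivAt_polyDisturbanceDeriv dbar k i t)
    refine (hasDerivAt_pi.1 h2 b).congr_deriv ?_
    simp only [stackedDisturbance, layerSignal, coupling, Fin.succ_ne_zero, if_false,
      Pi.add_apply, Pi.zero_apply, Fin.val_succ]
    ring

end

/-- Halanay's inequality for the curves `T_i z_i`. Both the initial error and the disturbance pass
through `T`, hence the factor `‖T‖` on each term. -/
theorem cmpstNorm_blockDiag_stackedError_le {net : MultiplexNetwork N n o l m q}
    {p : ℝ≥0∞} [Fact (1 ≤ p)] {η : Fin N → ℝ} (hη : ∀ i, 0 < η i) (hnet : net.IsSmooth)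
    {t0 τmax : ℝ} (hτmax : 0 < τmax) (hτ : ∀ κ t, t0 ≤ t → net.τ κ t ∈ Ioc 0 τmax)
    {xl : ℝ → Fin l → ℝ} {xs : ℝ → Fin N → Fin n → ℝ} (hxs : net.IsDesiredSolution t0 τmax xs)
    {T : Fin N → Matrix (Fin (m + 1) × Fin n) (Fin (m + 1) × Fin n) ℝ} (hT : ∀ i, IsUnit (T i))
    {σlow σbar : ℝ} (hσ : σlow < σbar) (hC1 : net.CondC1 t0 xl xs)
    (hC2 : net.CondC2 p η T t0 σbar) (hC3 : net.CondC3 p η T t0 σlow)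
    {lam : ℝ} (hlam : 0 < lam) (hrate : lam - σbar + σlow * Real.exp (lam * τmax) = 0)
    {dbar : ℕ → Fin N → Fin n → ℝ} {w : ℝ → Fin N → Fin n → ℝ}
    {x : ℝ → Fin N → Fin n → ℝ} {r : ℝ → Fin m → Fin N → Fin n → ℝ}
    (hsol : net.IsSolution t0 τmax xl dbar w x r) {D W : ℝ} (hD : 0 ≤ D) (hW : 0 ≤ W)
    (hinit : ∀ t ∈ Icc (t0 - τmax) t0, cmpstNorm p η (stackedError xs dbar x r t) ≤ D)
    (hw : ∀ t, t0 ≤ t → cmpstNorm p η (w t) ≤ W) {t : ℝ} (ht : t0 ≤ t) :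
    cmpstNorm p η (blockDiag T (stackedError xs dbar x r t)) ≤
      cmpstOpNorm p η (blockDiag T) * D * Real.exp (-lam * (t - t0)) +
        cmpstOpNorm p η (blockDiag T) * W / (σbar - σlow) := by
  set z := stackedError xs dbar x r with hz
  have hop := cmpstOpNorm_nonneg (p := p) hη (blockDiag T)
  have hbound : ∀ (v : Fin N → Fin (m + 1) × Fin n → ℝ) (a : ℝ), cmpstNorm p η v ≤ a → ∀ i,
      lpNorm p ((T i).mulVec (v i)) ≤ η i * (cmpstOpNorm p η (blockDiag T) * a) :=
    fun v a hv i => (lpNorm_le_mul_cmpstNorm hη (blockDiag T v) i).trans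
      (mul_le_mul_of_nonneg_left ((cmpstNorm_blockDiag_le hη T v).trans
        (mul_le_mul_of_nonneg_left hv hop)) (hη i).le)
  let Γ : Fin N → (Fin (m + 1) × Fin n → ℝ) →L[ℝ] PiLp p fun _ : Fin (m + 1) × Fin n => ℝ :=
    fun i => LinearMap.toContinuousLinearMap
      ((WithLp.linearEquiv p ℝ (Fin (m + 1) × Fin n → ℝ)).symm.toLinearMap ∘ₗ (T i).mulVecLin)
  have hΓ : ∀ i u, Γ i u = WithLp.toLp p ((T i).mulVec u) := fun i u => rfl
  obtain ⟨S, hS, hode⟩ := hsol.ode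
  have key := norm_le_of_halanay (ζ := fun i t => Γ i (z t i)) hη hτmax hσ hlam hrate
    (mul_nonneg hop hD) (mul_nonneg hop hW)
    (fun i => (Γ i).continuous.comp_continuousOn
      (continuousOn_stackedError hxs.1 hsol.continuousOn_x hsol.continuousOn_r i))
    (fun i s hs => hbound (z s) D (hinit s hs) i) hS
    (fun t ht htS i => by
      obtain ⟨hx, hr⟩ := hode t ht htS
      refine ⟨_, (Γ i).hasFDerivAt.comp_hasDerivAt t
        (hasDerivAt_stackedError hxs hC1 ht hx hr i), fun ψ a b hψ hψz hi ha hb => ?_⟩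
      have hb0 : 0 ≤ b := nonneg_of_mul_nonneg_right ((norm_nonneg _).trans
        (hb i (t - τmax) ⟨le_rfl, by linarith⟩)) (hη i)
      -- The segment starts at `xs` and ends at `x`. Strict positivity of the delays places the
      -- delayed times in the half-open window before `t`.
      have hmain := dual_stackedField_sub_le hnet hη hT hC2 hC3 ht.le xl xs z i hψ hb0 hψz hi ha
        (fun κ j => hb j _ ⟨by linarith [(hτ κ t ht.le).2], by linarith [(hτ κ t ht.le).1]⟩)
      have hX : ∀ s, (xs s + fun j b => z s j (0, b)) = x s := fun s => by
        funext j b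
        simp [hz, stackedError]
      simp only [hX] at hmain
      have hdist : ψ (Γ i (stackedDisturbance m (w t) i)) ≤
          η i * (cmpstOpNorm p η (blockDiag T) * W) :=
        (dual_le_lpNorm hψ _).trans (hbound _ W
          ((cmpstNorm_stackedDisturbance_le hη _).trans (hw t ht.le)) i)
      rw [map_add, map_add, mul_add]
      exact add_le_add hmain hdist)
    t (by linarith)
  exact cmpstNorm_le hη (by have := sub_pos.2 hσ; positivity) key

theorem outputError_le {net : MultiplexNetwork N n o l m q}
    {p : ℝ≥0∞} [Fact (1 ≤ p)] {η : Fin N → ℝ} (hη : ∀ i, 0 < η i) {L : ℝ≥0}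
    (hg : ∀ i u v, lpNorm p (net.g i u - net.g i v) ≤ L * lpNorm p (u - v))
    (xs x : ℝ → Fin N → Fin n → ℝ) (t : ℝ) :
    net.outputError p η xs x t ≤ L * cmpstNorm p η (x t - xs t) := by
  refine cmpstNorm_le hη (mul_nonneg L.coe_nonneg (cmpstNorm_nonneg hη _)) fun i => (hg i _ _).trans ?_
  have := mul_le_mul_of_nonneg_left (lpNorm_le_mul_cmpstNorm (p := p) hη (x t - xs t) i) L.coe_nonneg
  refine this.trans (le_of_eq ?_)
  ring

end MultiplexNetwork

/-! ### Stability of the closed loop -/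

theorem isClassKL_mul_exp {c lam : ℝ} (hc : 0 < c) (hlam : 0 < lam) :
    IsClassKL fun a s => c * Real.exp (-lam * s) * a := by
  refine ⟨by fun_prop, fun s _ => ⟨by fun_prop, ?_, mul_zero _⟩, fun a ha => ⟨?_, ?_⟩⟩
  · intro a _ b _ hab
    exact mul_lt_mul_of_pos_left hab (by positivity)
  · intro s _ s' _ hs
    have : Real.exp (-lam * s') ≤ Real.exp (-lam * s) := by
      rw [Real.exp_le_exp]; nlinarith
    exact mul_le_mul_of_nonneg_right (mul_le_mul_of_nonneg_left this hc.le) ha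
  · have h : Tendsto (fun s : ℝ => -lam * s) atTop atBot :=
      tendsto_id.const_mul_atTop_of_neg (by linarith)
    simpa using ((Real.tendsto_exp_atBot.comp h).const_mul c).mul_const a

theorem isClassK_const_mul {c : ℝ} (hc : 0 < c) : IsClassK fun a => c * a :=
  ⟨by fun_prop, fun _ _ _ _ hab => mul_lt_mul_of_pos_left hab hc, mul_zero _⟩

theorem proposition1 {N n o l m q : ℕ} (net : MultiplexNetwork N n o l m q)
    (p : ℝ≥0∞) [Fact (1 ≤ p)] (η : Fin N → ℝ) (hη : ∀ i, 0 < η i)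
    (hsmooth : net.IsSmooth)
    (L : ℝ≥0) (hg : ∀ i u v, lpNorm p (net.g i u - net.g i v) ≤ L * lpNorm p (u - v))
    (t0 τmax : ℝ) (hτmax : 0 < τmax)
    (hτ : ∀ κ t, t0 ≤ t → net.τ κ t ∈ Set.Ioc 0 τmax)
    (xl : ℝ → Fin l → ℝ) (xs : ℝ → Fin N → Fin n → ℝ)
    (hxs : net.IsDesiredSolution t0 τmax xs)
    (T : Fin N → Matrix (Fin (m + 1) × Fin n) (Fin (m + 1) × Fin n) ℝ)
    (hT : ∀ i, IsUnit (T i))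
    (σlow σbar : ℝ) (hσlow : 0 < σlow) (hσ : σlow < σbar)
    (hC1 : net.CondC1 t0 xl xs)
    (hC2 : net.CondC2 p η T t0 σbar)
    (hC3 : net.CondC3 p η T t0 σlow) :
    net.IsInputOutputStable p η t0 τmax xl xs ∧
    ∃ lam : ℝ, 0 < lam ∧ lam - σbar + σlow * Real.exp (lam * τmax) = 0 ∧
      (∀ lam' : ℝ, lam' - σbar + σlow * Real.exp (lam' * τmax) = 0 → lam' = lam) ∧
      ∀ (dbar : ℕ → Fin N → Fin n → ℝ) (w : ℝ → Fin N → Fin n → ℝ)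
        (x : ℝ → Fin N → Fin n → ℝ) (r : ℝ → Fin m → Fin N → Fin n → ℝ),
        BddAbove (Set.range fun s : Set.Ici t0 => cmpstNorm p η (w s)) →
        net.IsSolution t0 τmax xl dbar w x r →
        ∀ t, t0 ≤ t →
          net.outputError p η xs x t ≤
            L * (cmpstOpNorm p η (blockDiag fun i => (T i)⁻¹) * cmpstOpNorm p η (blockDiag T) *
                Real.exp (-lam * (t - t0)) *
                ((⨆ s : Set.Icc (t0 - τmax) t0, cmpstNorm p η (x s - xs s)) +
                  ⨆ s : Set.Icc (t0 - τmax) t0, ∑ k : Fin m,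
                    cmpstNorm p η (MultiplexNetwork.shiftedIntegrator dbar r k s)) +
              cmpstOpNorm p η (blockDiag fun i => (T i)⁻¹) * cmpstOpNorm p η (blockDiag T) /
                (σbar - σlow) * ⨆ s : Set.Ici t0, cmpstNorm p η (w s)) := by
  have hσ' : 0 < σbar - σlow := sub_pos.2 hσ
  obtain ⟨lam, hlam, hrate, huniq⟩ := existsUnique_halanay_rate hσlow hσ hτmax
  set cT := cmpstOpNorm p η (blockDiag T) with hcT
  set cT' := cmpstOpNorm p η (blockDiag fun i => (T i)⁻¹) with hcT'
  have hcT0 : 0 ≤ cT := cmpstOpNorm_nonneg hη _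
  have hcT0' : 0 ≤ cT' := cmpstOpNorm_nonneg hη _
  have main : ∀ (dbar : ℕ → Fin N → Fin n → ℝ) (w : ℝ → Fin N → Fin n → ℝ)
      (x : ℝ → Fin N → Fin n → ℝ) (r : ℝ → Fin m → Fin N → Fin n → ℝ),
      BddAbove (Set.range fun s : Set.Ici t0 => cmpstNorm p η (w s)) →
      net.IsSolution t0 τmax xl dbar w x r → ∀ t, t0 ≤ t →
      net.outputError p η xs x t ≤
        L * (cT' * cT * Real.exp (-lam * (t - t0)) *
            ((⨆ s : Set.Icc (t0 - τmax) t0, cmpstNorm p η (x s - xs s)) +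
              ⨆ s : Set.Icc (t0 - τmax) t0, ∑ k : Fin m,
                cmpstNorm p η (MultiplexNetwork.shiftedIntegrator dbar r k s)) +
          cT' * cT / (σbar - σlow) * ⨆ s : Set.Ici t0, cmpstNorm p η (w s)) := by
    intro dbar w x r hw hsol t ht
    have hsub : Icc (t0 - τmax) t0 ⊆ Ici (t0 - τmax) := fun s hs => hs.1
    -- A real supremum dominates its family only if the family is bounded; here this follows from
    -- continuity on the compact history interval.
    have hbx : BddAbove (Set.range fun s : Icc (t0 - τmax) t0 => cmpstNorm p η (x s - xs s)) :=
      ContinuousOn.bddAbove_range_Icc (f := fun s => cmpstNorm p η (x s - xs s))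
        (continuous_cmpstNorm.comp_continuousOn
          ((hsol.continuousOn_x.mono hsub).sub (hxs.1.mono hsub)))
    have hbr : BddAbove (Set.range fun s : Icc (t0 - τmax) t0 => ∑ k : Fin m,
        cmpstNorm p η (MultiplexNetwork.shiftedIntegrator dbar r k s)) :=
      ContinuousOn.bddAbove_range_Icc (f := fun s => ∑ k : Fin m,
        cmpstNorm p η (MultiplexNetwork.shiftedIntegrator dbar r k s))
        (continuousOn_finsetSum _ fun k _ => continuous_cmpstNorm.comp_continuousOn
          (continuousOn_pi.2 fun i => MultiplexNetwork.continuousOn_shiftedIntegrator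
            (hsol.continuousOn_r.mono hsub) k i))
    have hsx : 0 ≤ ⨆ s : Icc (t0 - τmax) t0, cmpstNorm p η (x s - xs s) :=
      Real.iSup_nonneg fun s => cmpstNorm_nonneg hη _
    have hsr : 0 ≤ ⨆ s : Icc (t0 - τmax) t0, ∑ k : Fin m,
        cmpstNorm p η (MultiplexNetwork.shiftedIntegrator dbar r k s) :=
      Real.iSup_nonneg fun s => Finset.sum_nonneg fun k _ => cmpstNorm_nonneg hη _
    have hT' : blockDiag (fun i => (T i)⁻¹)
        (blockDiag T (MultiplexNetwork.stackedError xs dbar x r t)) =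
        MultiplexNetwork.stackedError xs dbar x r t := by
      funext i
      change (T i)⁻¹.mulVec ((T i).mulVec _) = _
      rw [Matrix.mulVec_mulVec,
        Matrix.nonsing_inv_mul _ ((Matrix.isUnit_iff_isUnit_det _).1 (hT i)), Matrix.one_mulVec]
      rfl
    have hz := MultiplexNetwork.cmpstNorm_blockDiag_stackedError_le hη hsmooth hτmax hτ hxs hT hσ
      hC1 hC2 hC3 hlam hrate hsol (add_nonneg hsx hsr)
      (Real.iSup_nonneg fun s : Ici t0 => cmpstNorm_nonneg (p := p) hη (w s))
      (fun s hs => (MultiplexNetwork.cmpstNorm_stackedError_le hη s).trans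
        (add_le_add (le_ciSup hbx ⟨s, hs⟩) (le_ciSup hbr ⟨s, hs⟩)))
      (fun s hs => le_ciSup hw ⟨s, hs⟩) ht
    have hinv := cmpstNorm_blockDiag_le (p := p) hη (fun i => (T i)⁻¹)
      (blockDiag T (MultiplexNetwork.stackedError xs dbar x r t))
    rw [hT'] at hinv
    refine (MultiplexNetwork.outputError_le hη hg xs x t).trans
      (mul_le_mul_of_nonneg_left ?_ L.coe_nonneg)
    refine (MultiplexNetwork.cmpstNorm_sub_le_stackedError hη t).trans (hinv.trans
      ((mul_le_mul_of_nonneg_left hz hcT0').trans (le_of_eq ?_)))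
    ring
  refine ⟨?_, lam, hlam, hrate, huniq, main⟩
  -- The added `1` keeps the gains strictly positive, as class `K` requires, even if `L` or an
  -- operator norm is zero.
  have hc : 0 < L * (cT' * cT) + 1 :=
    add_pos_of_nonneg_of_pos (mul_nonneg L.coe_nonneg (mul_nonneg hcT0' hcT0)) one_pos
  refine ⟨_, _, _, isClassKL_mul_exp hc hlam, isClassKL_mul_exp hc hlam,
    isClassK_const_mul (div_pos hc hσ'), fun dbar w x r hw hsol t ht => ?_⟩
  have hshift : ∀ (k : Fin m) (s : ℝ),
      (fun i => r s k i + iteratedDeriv (k : ℕ) (MultiplexNetwork.polyDisturbance m dbar i) s) =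
        MultiplexNetwork.shiftedIntegrator dbar r k s := fun k s => by
    funext i
    rw [MultiplexNetwork.iteratedDeriv_polyDisturbance, MultiplexNetwork.shiftedIntegrator_eq]
  simp only [hshift]
  refine (main dbar w x r hw hsol t ht).trans ?_
  have hsx : 0 ≤ ⨆ s : Icc (t0 - τmax) t0, cmpstNorm p η (x s - xs s) :=
    Real.iSup_nonneg fun s => cmpstNorm_nonneg hη _
  have hsr : 0 ≤ ⨆ s : Icc (t0 - τmax) t0, ∑ k : Fin m,
      cmpstNorm p η (MultiplexNetwork.shiftedIntegrator dbar r k s) :=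
    Real.iSup_nonneg fun s => Finset.sum_nonneg fun k _ => cmpstNorm_nonneg hη _
  have hsw : 0 ≤ ⨆ s : Ici t0, cmpstNorm p η (w s) :=
    Real.iSup_nonneg fun s => cmpstNorm_nonneg hη _
  have hexp := (Real.exp_pos (-lam * (t - t0))).le
  have h1 := mul_nonneg hexp (add_nonneg hsx hsr)
  have h2 := div_nonneg hsw hσ'.le
  refine sub_nonneg.1 ((add_nonneg h1 h2).trans (le_of_eq ?_))
  ring
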